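/- All quantum systems are finite-dimensional with nonzero Hilbert space, $H(\rho)=-\operatorname{Tr}(\rho\log_2\rho)$ is the von Neumann entropy, $I(A;B)_\rho=H(A)_\rho+H(B)_\rho-H(AB)_\rho$ is the quantum mutual information, and a quantum channel is a linear completely positive trace-preserving map. A quantum broadcast channel $\mathcal N_{A\to\mathcal B\cup\mathcal E}$ is a quantum channel from a system $A$ to the joint system of a finite set $\mathcal B\cup\mathcal E$ of receivers' systems, where the decoding set $\mathcal B$ and the malicious set $\mathcal E$ may overlap. It is degraded if there is a quantum channel $\mathcal T$ from the joint system of $\mathcal B$ to the joint system of $\mathcal E$ such that $$\mathcal T\bigl(\operatorname{Tr}_{(\mathcal B\cup\mathcal E)\setminus\mathcal B}\{\mathcal N(\rho)\}\bigr)=\operatorname{Tr}_{(\mathcal B\cup\mathcal E)\setminus\mathcal E}\{\mathcal N(\rho)\}$$ for every state $\rho$ of $A$. Its entanglement-assisted (EA) private information is $$\mathcal P_{EA}(\mathcal N)=\sup_{\rho_{RA}}\bigl[I(R;\mathcal B)_\omega-I(R;\mathcal E)_\omega\bigr],\qquad \omega_{R\mathcal B\cup\mathcal E}=(\mathrm{id}_R\otimes\mathcal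 N)(\rho_{RA}),$$ where the supremum is over all finite-dimensional reference systems $R$ and all (pure or mixed) states $\rho_{RA}$. Lemma. Let $\mathcal N_{A_1\to\mathcal B_1\cup\mathcal E_1}$ and $\mathcal M_{A_2\to\mathcal B_2\cup\mathcal E_2}$ be degraded quantum broadcast channels, and let $\mathcal N\otimes\mathcal M$ be the broadcast channel with input $A_1A_2$, decoding set $\mathcal B_1\cup\mathcal B_2$ and malicious set $\mathcal E_1\cup\mathcal E_2$ (the receivers of $\mathcal N$ being distinct from those of $\mathcal M$). Then the suprema defining $\mathcal P_{EA}(\mathcal N)$, $\mathcal P_{EA}(\mathcal M)$ and $\mathcal P_{EA}(\mathcal N\otimes\mathcal M)$ are finite, and $$\mathcal P_{EA}(\mathcal N\otimes\mathcal M)=\mathcal P_{EA}(\mathcal N)+\mathcal P_{EA}(\mathcal M).$$ -/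

import Mathlib

open scoped ComplexOrder

/-! Finite-dimensional quantum information: a quantum system is given by a finite index type `a`
(an orthonormal basis of its Hilbert space `ℂ^a`), operators are complex matrices indexed by `a`, and
the tensor product of the systems `a` and `b` is the system `a × b`. -/

/-- A density operator: positive semidefinite of trace one. -/
def IsDensity {a : Type*} [Fintype a] (ρ : Matrix a a ℂ) : Prop :=
  ρ.PosSemidef ∧ ρ.trace = 1

/-- The map `id_r ⊗ Φ`, which applies `Φ` to the second factor of `r × a`. -/
def idTensor (r : Type*) {a b : Type*} (Φ : Matrix a a ℂ →ₗ[ℂ] Matrix b b ℂ) :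
    Matrix (r × a) (r × a) ℂ →ₗ[ℂ] Matrix (r × b) (r × b) ℂ where
  toFun X := Matrix.of fun p q => Φ (Matrix.of fun x y => X (p.1, x) (q.1, y)) p.2 q.2
  map_add' X Y := by
    ext p q
    exact congrFun (congrFun (map_add Φ (Matrix.of fun x y => X (p.1, x) (q.1, y))
      (Matrix.of fun x y => Y (p.1, x) (q.1, y))) p.2) q.2
  map_smul' c X := by
    ext p q
    exact congrFun (congrFun (map_smul Φ c (Matrix.of fun x y => X (p.1, x) (q.1, y))) p.2) q.2

/-- The map `Φ ⊗ id_r`, which applies `Φ` to the first factor of `a × r`. -/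
def tensorId {a b : Type*} (Φ : Matrix a a ℂ →ₗ[ℂ] Matrix b b ℂ) (r : Type*) :
    Matrix (a × r) (a × r) ℂ →ₗ[ℂ] Matrix (b × r) (b × r) ℂ where
  toFun X := Matrix.of fun p q => Φ (Matrix.of fun x y => X (x, p.2) (y, q.2)) p.1 q.1
  map_add' X Y := by
    ext p q
    exact congrFun (congrFun (map_add Φ (Matrix.of fun x y => X (x, p.2) (y, q.2))
      (Matrix.of fun x y => Y (x, p.2) (y, q.2))) p.1) q.1
  map_smul' c X := by
    ext p q
    exact congrFun (congrFun (map_smul Φ c (Matrix.of fun x y => X (x, p.2) (y, q.2))) p.1) q.1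

/-- A quantum channel from the system `a` to the system `b`: a linear, completely positive and
trace-preserving map. -/
structure QuantumChannel (a b : Type*) [Fintype a] [Fintype b] where
  map : Matrix a a ℂ →ₗ[ℂ] Matrix b b ℂ
  completely_positive : ∀ (k : ℕ) (X : Matrix (Fin k × a) (Fin k × a) ℂ),
    X.PosSemidef → (idTensor (Fin k) map X).PosSemidef
  trace_preserving : ∀ X : Matrix a a ℂ, (map X).trace = X.trace

namespace QuantumChannel

/-- Complete positivity with an arbitrary finite system in place of `Fin k`. -/
theorem posSemidef_idTensor {a b : Type*} [Fintype a] [Fintype b] (Φ : QuantumChannel a b)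
    (r : Type*) [Fintype r] (X : Matrix (r × a) (r × a) ℂ) (hX : X.PosSemidef) :
    (idTensor r Φ.map X).PosSemidef := by
  have e := Fintype.equivFin r
  have h := Φ.completely_positive (Fintype.card r) _
    (hX.submatrix (Prod.map e.symm (id : a → a)))
  have h2 := h.submatrix (Prod.map e (id : b → b))
  convert h2 using 1
  ext p q
  simp [idTensor, Matrix.submatrix]

/-- The tensor product `Φ ⊗ Ψ = (Φ ⊗ id) ∘ (id ⊗ Ψ)` of two channels. -/
def tensor {a₁ b₁ a₂ b₂ : Type*} [Fintype a₁] [Fintype b₁] [Fintype a₂] [Fintype b₂]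
    (Φ : QuantumChannel a₁ b₁) (Ψ : QuantumChannel a₂ b₂) :
    QuantumChannel (a₁ × a₂) (b₁ × b₂) where
  map := (tensorId Φ.map b₂).comp (idTensor a₁ Ψ.map)
  completely_positive k X hX := by
    have h1 := Ψ.posSemidef_idTensor (Fin k × a₁) _
      (hX.submatrix (fun p : (Fin k × a₁) × a₂ => (p.1.1, (p.1.2, p.2))))
    have h2 := Φ.posSemidef_idTensor (Fin k × b₂) _
      (h1.submatrix (fun p : (Fin k × b₂) × a₁ => ((p.1.1, p.2), p.1.2)))
    exact h2.submatrix (fun p : Fin k × (b₁ × b₂) => ((p.1, p.2.2), p.2.1))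
  trace_preserving X := by
    have h1 : ∀ Y : Matrix (a₁ × b₂) (a₁ × b₂) ℂ, (tensorId Φ.map b₂ Y).trace = Y.trace := by
      intro Y
      have h := fun j : b₂ => Φ.trace_preserving (Matrix.of fun x y => Y (x, j) (y, j))
      simp only [Matrix.trace, Matrix.diag, Matrix.of_apply] at h
      simp only [Matrix.trace, Matrix.diag, tensorId, LinearMap.coe_mk, AddHom.coe_mk,
        Matrix.of_apply, Fintype.sum_prod_type_right, h]
    have h2 : (idTensor a₁ Ψ.map X).trace = X.trace := by
      have h := fun i : a₁ => Ψ.trace_preserving (Matrix.of fun x y => X (i, x) (i, y))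
      simp only [Matrix.trace, Matrix.diag, Matrix.of_apply] at h
      simp only [Matrix.trace, Matrix.diag, idTensor, LinearMap.coe_mk, AddHom.coe_mk,
        Matrix.of_apply, Fintype.sum_prod_type, h]
    rw [LinearMap.comp_apply, h1, h2]

/-- Relabelling of the basis of the output system. -/
def relabel {a b c : Type*} [Fintype a] [Fintype b] [Fintype c]
    (Φ : QuantumChannel a b) (e : c ≃ b) : QuantumChannel a c where
  map := (Matrix.reindexLinearEquiv ℂ ℂ e.symm e.symm).toLinearMap.comp Φ.map
  completely_positive k X hX :=
    (Φ.completely_positive k X hX).submatrix (Prod.map (id : Fin k → Fin k) e)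
  trace_preserving X := by
    rw [← Φ.trace_preserving X]
    simp only [Matrix.trace, Matrix.diag, LinearMap.comp_apply, LinearEquiv.coe_coe,
      Matrix.coe_reindexLinearEquiv, Matrix.reindex_apply, Matrix.submatrix_apply, Equiv.symm_symm]
    exact Equiv.sum_comp e (fun i => Φ.map X i i)

end QuantumChannel

/-- The von Neumann entropy `H(ρ) = -Tr(ρ log₂ ρ)`. The operator `-ρ log ρ` is formed in
the continuous functional calculus, where `Real.negMulLog x = -x log x`, with value `0` at `0`. -/
noncomputable def vonNeumannEntropy {a : Type*} [Fintype a] [DecidableEq a]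
    (ρ : Matrix a a ℂ) : ℝ :=
  (cfc Real.negMulLog ρ).trace.re / Real.log 2

/-- The marginal on the first factor. -/
def marginalFst {a b : Type*} [Fintype b] (ρ : Matrix (a × b) (a × b) ℂ) : Matrix a a ℂ :=
  Matrix.of fun i j => ∑ k, ρ (i, k) (j, k)

/-- The marginal on the second factor. -/
def marginalSnd {a b : Type*} [Fintype a] (ρ : Matrix (a × b) (a × b) ℂ) : Matrix b b ℂ :=
  Matrix.of fun i j => ∑ k, ρ (k, i) (k, j)

/-- The quantum mutual information `I(A;B)_ρ = H(A)_ρ + H(B)_ρ - H(AB)_ρ`. -/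
noncomputable def mutualInformation {a b : Type*} [Fintype a] [DecidableEq a] [Fintype b]
    [DecidableEq b] (ρ : Matrix (a × b) (a × b) ℂ) : ℝ :=
  vonNeumannEntropy (marginalFst ρ) + vonNeumannEntropy (marginalSnd ρ) - vonNeumannEntropy ρ

/-- The joint system of the members of `S`, the `i`-th of which has dimension `d i`. -/
abbrev SystemOf {ι : Type*} (d : ι → ℕ) (S : Finset ι) : Type _ :=
  (i : {i : ι // i ∈ S}) → Fin (d i)

/-- The partial trace over all systems outside `S`. -/
def partialTraceTo {ι : Type*} [Fintype ι] [DecidableEq ι] (d : ι → ℕ) (S : Finset ι) :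
    Matrix ((i : ι) → Fin (d i)) ((i : ι) → Fin (d i)) ℂ →ₗ[ℂ]
      Matrix (SystemOf d S) (SystemOf d S) ℂ where
  toFun X := Matrix.of fun x y => ∑ z : (i : {i : ι // ¬ i ∈ S}) → Fin (d i),
    X ((Equiv.piEquivPiSubtypeProd (fun i => i ∈ S) fun i => Fin (d i)).symm (x, z))
      ((Equiv.piEquivPiSubtypeProd (fun i => i ∈ S) fun i => Fin (d i)).symm (y, z))
  map_add' X Y := by
    ext x y
    simp [Finset.sum_add_distrib]
  map_smul' c X := by
    ext x y
    simp [Finset.mul_sum]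

/-- A quantum broadcast channel with input system `a` and finitely many receivers' systems,
indexed by `ι`, of dimensions `dim i`; the decoding set and the malicious set together contain all
the output systems, and may overlap. -/
structure BroadcastChannel (a ι : Type*) [Fintype a] [Fintype ι] [DecidableEq ι] where
  dim : ι → ℕ
  channel : QuantumChannel a ((i : ι) → Fin (dim i))
  decoding : Finset ι
  malicious : Finset ι
  decoding_union_malicious : decoding ∪ malicious = Finset.univ

namespace BroadcastChannel

section

variable {a ι : Type*} [Fintype a] [Fintype ι] [DecidableEq ι]

/-- A channel acting on the decoding set turns the decoding set's output state into
the malicious set's output state, for every input state. -/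
def IsDegraded (N : BroadcastChannel a ι) : Prop :=
  ∃ T : QuantumChannel (SystemOf N.dim N.decoding) (SystemOf N.dim N.malicious),
    ∀ ρ : Matrix a a ℂ, IsDensity ρ →
      T.map (partialTraceTo N.dim N.decoding (N.channel.map ρ)) =
        partialTraceTo N.dim N.malicious (N.channel.map ρ)

/-- `I(R;ℬ)_ω - I(R;ℰ)_ω` for `ω = (id_R ⊗ N)(ρ)`, where `ℬ` is the decoding set and `ℰ` is the
malicious set. -/
noncomputable def informationDifference (N : BroadcastChannel a ι) {r : Type*} [Fintype r]
    [DecidableEq r] (ρ : Matrix (r × a) (r × a) ℂ) : ℝ :=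
  mutualInformation (idTensor r (partialTraceTo N.dim N.decoding) (idTensor r N.channel.map ρ)) -
    mutualInformation (idTensor r (partialTraceTo N.dim N.malicious) (idTensor r N.channel.map ρ))

/-- The values of `I(R;ℬ)_ω - I(R;ℰ)_ω` over all states `ρ_{RA}`, pure or mixed, with a reference
system `R` of any finite dimension. -/
def privateInformationValues (N : BroadcastChannel a ι) : Set ℝ :=
  {v | ∃ (k : ℕ) (ρ : Matrix (Fin k × a) (Fin k × a) ℂ),
    IsDensity ρ ∧ v = N.informationDifference ρ}

/-- The entanglement-assisted private information `P_EA(N)`. -/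
noncomputable def privateInformationEA (N : BroadcastChannel a ι) : ℝ :=
  sSup N.privateInformationValues

end

/-- The tensor product `N ⊗ M`: the receivers are those of `N` and those of `M`, the decoding
set is `ℬ₁ ∪ ℬ₂`, and the malicious set is `ℰ₁ ∪ ℰ₂`. -/
def tensor {a₁ ι₁ a₂ ι₂ : Type*} [Fintype a₁] [Fintype ι₁] [DecidableEq ι₁]
    [Fintype a₂] [Fintype ι₂] [DecidableEq ι₂]
    (N : BroadcastChannel a₁ ι₁) (M : BroadcastChannel a₂ ι₂) :
    BroadcastChannel (a₁ × a₂) (ι₁ ⊕ ι₂) where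
  dim := Sum.elim N.dim M.dim
  channel := (N.channel.tensor M.channel).relabel
    (Equiv.sumPiEquivProdPi fun i => Fin (Sum.elim N.dim M.dim i))
  decoding := N.decoding.disjSum M.decoding
  malicious := N.malicious.disjSum M.malicious
  decoding_union_malicious := by
    ext i
    have hN := fun j => Finset.ext_iff.mp N.decoding_union_malicious j
    have hM := fun j => Finset.ext_iff.mp M.decoding_union_malicious j
    simp only [Finset.mem_union, Finset.mem_univ, iff_true] at hN hM
    cases i with
    | inl j => simpa using hN j
    | inr j => simpa using hM j

end BroadcastChannel

/-! Superadditivity comes from product inputs: every entropy in the information difference is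
additive on `ρ ⊗ σ`, so the values add (`infoDiff_tensor_kronecker`).

For subadditivity, write B for the decoding and C for the malicious outputs. Since H(R) cancels,
I(R;B) - I(R;C) = H(B) - H(RB) - H(C) + H(RC). Evaluate the first channel with reference R B₂ and
the second with reference R C₁. The terms H(R C₁ B₂) cancel, and the sum exceeds the value for the
tensor product by I(B₁;B₂) - I(C₁;C₂). Degradedness makes C₁C₂ the image of B₁B₂ under local
channels, so this excess is nonnegative by data processing (`infoDiff_tensor_le`,
`mutualInformation_tensor_map_le`).

Data processing is monotonicity of D(ρ‖σ) at σ = ρ_A ⊗ ρ_B. With eigenvalues p, q and squared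
overlaps w of the eigenbases, F(t) = ∑ w (p log(p + tq) - p log p) satisfies F(0) = 0 and F(t) - Tr
ρ · log t → -D(ρ‖σ), and F' = ∑ w pq/(p + tq) is `quasiEntropy`. For t > 0 the latter is the minimum
over X of t⁻¹ Tr X*ρX + Tr (1-X)σ(1-X)*. Pulling X back through the adjoint of a channel does not
increase either trace, by the Schwarz inequality, so F' cannot decrease under the channel and D
cannot increase.

Finiteness needs a bound independent of R: I(R;C) ≥ 0 by Klein's inequality, H(B) is bounded by
dimension, and H(R) - H(RB) ≤ log d_B follows from ρ_{RB} ≤ d_B ρ_R ⊗ 1. -/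

open Matrix in
/-- `ρ = U diag(p) U*` with `U` unitary and `p` real. -/
def IsDiagonalization {n : Type*} [Fintype n] [DecidableEq n] (ρ U : Matrix n n ℂ) (p : n → ℝ) :
    Prop :=
  U ∈ unitaryGroup n ℂ ∧ ρ = U * diagonal (fun i => (p i : ℂ)) * Uᴴ

/-! ### Spectral decompositions and entropy -/

namespace IsDiagonalization

open Matrix Polynomial Kronecker

variable {n m : Type*} [Fintype n] [DecidableEq n] [Fintype m] [DecidableEq m]
  {ρ U : Matrix n n ℂ} {p : n → ℝ} {σ V : Matrix m m ℂ} {q : m → ℝ}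

theorem conjTranspose_mul_self (h : IsDiagonalization ρ U p) : Uᴴ * U = 1 :=
  mem_unitaryGroup_iff'.mp h.1

theorem mul_conjTranspose_self (h : IsDiagonalization ρ U p) : U * Uᴴ = 1 :=
  mem_unitaryGroup_iff.mp h.1

theorem of_isHermitian (hρ : ρ.IsHermitian) :
    IsDiagonalization ρ (hρ.eigenvectorUnitary : Matrix n n ℂ) hρ.eigenvalues :=
  ⟨hρ.eigenvectorUnitary.2, hρ.spectral_theorem⟩

theorem exists_of_posSemidef (hρ : ρ.PosSemidef) :
    ∃ (U : Matrix n n ℂ) (p : n → ℝ), IsDiagonalization ρ U p ∧ ∀ i, 0 ≤ p i :=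
  ⟨_, _, of_isHermitian hρ.1, hρ.eigenvalues_nonneg⟩

theorem isHermitian (h : IsDiagonalization ρ U p) : ρ.IsHermitian := by
  rw [h.2]
  refine isHermitian_mul_mul_conjTranspose U ?_
  simp [Matrix.IsHermitian, diagonal_conjTranspose, Pi.star_def]

theorem roots_charpoly (h : IsDiagonalization ρ U p) :
    ρ.charpoly.roots = Multiset.map (fun i => (p i : ℂ)) Finset.univ.val := by
  have : ρ.charpoly = ∏ i, (X - C (p i : ℂ)) := by
    rw [h.2, charpoly_mul_comm, ← mul_assoc, h.conjTranspose_mul_self, one_mul, charpoly_diagonal]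
  rw [this, Finset.prod, ← roots_multiset_prod_X_sub_C
    (Multiset.map (fun i => (p i : ℂ)) Finset.univ.val), Multiset.map_map]
  rfl

/-- Both families list the roots of the characteristic polynomial with multiplicity. Hence entropy
can be computed in any eigenbasis, in particular in product eigenbases. -/
theorem sum_eq (h : IsDiagonalization ρ U p) {V : Matrix n n ℂ} {q : n → ℝ}
    (h' : IsDiagonalization ρ V q) (f : ℝ → ℝ) : ∑ i, f (p i) = ∑ i, f (q i) := by
  have e := h.roots_charpoly.symm.trans h'.roots_charpoly
  have e' := congrArg (fun s => (s.map fun z : ℂ => f z.re).sum) e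
  simpa [Multiset.map_map] using e'

theorem vonNeumannEntropy_eq (h : IsDiagonalization ρ U p) :
    vonNeumannEntropy ρ = (∑ i, Real.negMulLog (p i)) / Real.log 2 := by
  have hH := h.isHermitian
  have h' := of_isHermitian hH
  rw [h.sum_eq h', vonNeumannEntropy, hH.cfc_eq, Matrix.IsHermitian.cfc,
    Unitary.conjStarAlgAut_apply, trace_mul_comm, ← mul_assoc]
  simp [trace_diagonal]

theorem sum_eigenvalues (h : IsDiagonalization ρ U p) : (∑ i, p i : ℝ) = ρ.trace.re := by
  rw [h.2, trace_mul_comm, ← mul_assoc, h.conjTranspose_mul_self, one_mul, trace_diagonal]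
  simp

theorem submatrix (h : IsDiagonalization ρ U p) (e : m ≃ n) :
    IsDiagonalization (ρ.submatrix e e) (U.submatrix e e) (p ∘ e) := by
  refine ⟨?_, ?_⟩
  · rw [mem_unitaryGroup_iff, star_eq_conjTranspose, conjTranspose_submatrix,
      submatrix_mul_equiv, h.mul_conjTranspose_self, submatrix_one_equiv]
  · rw [conjTranspose_submatrix, show diagonal (fun i => (((p ∘ e) i : ℝ) : ℂ)) =
      (diagonal (fun i => (p i : ℂ))).submatrix e e by rw [submatrix_diagonal_equiv]; rfl,
      submatrix_mul_equiv, submatrix_mul_equiv, ← h.2]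

theorem kronecker (h : IsDiagonalization ρ U p) (h' : IsDiagonalization σ V q) :
    IsDiagonalization (ρ ⊗ₖ σ) (U ⊗ₖ V) (fun i => p i.1 * q i.2) := by
  refine ⟨kronecker_mem_unitary h.1 h'.1, ?_⟩
  rw [conjTranspose_kronecker, show diagonal (fun i : n × m => ((p i.1 * q i.2 : ℝ) : ℂ)) =
      diagonal (fun i => (p i : ℂ)) ⊗ₖ diagonal (fun i => (q i : ℂ)) by
        rw [diagonal_kronecker_diagonal]; simp,
      ← mul_kronecker_mul, ← mul_kronecker_mul, ← h.2, ← h'.2]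

/-- `Tr X* ρ X` in an eigenbasis of `ρ` and an arbitrary basis. -/
theorem trace_conj_left (h : IsDiagonalization ρ U p) {V : Matrix n n ℂ} (hV : V * Vᴴ = 1)
    (X : Matrix n n ℂ) :
    (Xᴴ * ρ * X).trace.re = ∑ i, ∑ j, p i * Complex.normSq ((Uᴴ * X * V) i j) := by
  have e : (Xᴴ * ρ * X).trace =
      ((Uᴴ * X * V)ᴴ * diagonal (fun i => (p i : ℂ)) * (Uᴴ * X * V)).trace := by
    calc (Xᴴ * ρ * X).trace = (Xᴴ * ρ * X * (V * Vᴴ)).trace := by rw [hV, mul_one]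
      _ = _ := by
        rw [← mul_assoc, trace_mul_comm _ Vᴴ]
        conv_lhs => rw [h.2]
        simp only [conjTranspose_mul, conjTranspose_conjTranspose, mul_assoc]
  rw [e, Finset.sum_comm]
  simp only [trace, diag, mul_apply (N := Uᴴ * X * V), mul_diagonal, conjTranspose_apply,
    Complex.re_sum]
  refine Finset.sum_congr rfl fun j _ => Finset.sum_congr rfl fun i _ => ?_
  rw [mul_right_comm, Complex.star_def, ← Complex.normSq_eq_conj_mul_self, ← Complex.ofReal_mul,
    Complex.ofReal_re, mul_comm]

/-- `Tr X σ X*` in an eigenbasis of `σ` and an arbitrary basis. -/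
theorem trace_conj_right {σ V : Matrix n n ℂ} {q : n → ℝ} (h : IsDiagonalization σ V q)
    {U : Matrix n n ℂ} (hU : U * Uᴴ = 1) (X : Matrix n n ℂ) :
    (X * σ * Xᴴ).trace.re = ∑ i, ∑ j, q j * Complex.normSq ((Uᴴ * X * V) i j) := by
  have := h.trace_conj_left hU Xᴴ
  rw [conjTranspose_conjTranspose] at this
  rw [this, Finset.sum_comm]
  refine Finset.sum_congr rfl fun i _ => Finset.sum_congr rfl fun j _ => ?_
  rw [show Vᴴ * Xᴴ * U = (Uᴴ * X * V)ᴴ by simp [mul_assoc], conjTranspose_apply,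
    Complex.star_def, Complex.normSq_conj]

end IsDiagonalization

theorem vonNeumannEntropy_submatrix {n m : Type*} [Fintype n] [DecidableEq n] [Fintype m]
    [DecidableEq m] {ρ : Matrix n n ℂ} (hρ : ρ.IsHermitian) (e : m ≃ n) :
    vonNeumannEntropy (ρ.submatrix e e) = vonNeumannEntropy ρ := by
  have h := IsDiagonalization.of_isHermitian hρ
  rw [(h.submatrix e).vonNeumannEntropy_eq, h.vonNeumannEntropy_eq]
  congr 1
  exact Equiv.sum_comp e fun i => Real.negMulLog (hρ.eigenvalues i)

open Kronecker in
theorem vonNeumannEntropy_kronecker {n m : Type*} [Fintype n] [DecidableEq n] [Fintype m]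
    [DecidableEq m] {ρ : Matrix n n ℂ} {σ : Matrix m m ℂ} (hρ : IsDensity ρ) (hσ : IsDensity σ) :
    vonNeumannEntropy (ρ ⊗ₖ σ) = vonNeumannEntropy ρ + vonNeumannEntropy σ := by
  have h := IsDiagonalization.of_isHermitian hρ.1.1
  have h' := IsDiagonalization.of_isHermitian hσ.1.1
  have s := h.sum_eigenvalues
  have s' := h'.sum_eigenvalues
  replace s := s.trans (congrArg Complex.re hρ.2)
  replace s' := s'.trans (congrArg Complex.re hσ.2)
  rw [Complex.one_re] at s s'
  rw [(h.kronecker h').vonNeumannEntropy_eq, h.vonNeumannEntropy_eq, h'.vonNeumannEntropy_eq,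
    ← add_div]
  congr 1
  simp only [Real.negMulLog_mul, Fintype.sum_prod_type, Finset.sum_add_distrib, ← Finset.sum_mul,
    ← Finset.mul_sum, s, s', one_mul]

/-! ### Relative entropy in eigenbases -/

section RelativeEntropy

open Matrix

variable {n : Type*} [Fintype n]

/-- The squared overlaps `|⟨u_i, v_j⟩|²` of two bases. -/
noncomputable def overlap (U V : Matrix n n ℂ) (i j : n) : ℝ := Complex.normSq ((Uᴴ * V) i j)

theorem overlap_nonneg (U V : Matrix n n ℂ) (i j : n) : 0 ≤ overlap U V i j :=
  Complex.normSq_nonneg _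

/-- The parallel sum of `p` and `t q`, divided by `t`. -/
noncomputable def quasiEntropy (U : Matrix n n ℂ) (p : n → ℝ) (V : Matrix n n ℂ) (q : n → ℝ)
    (t : ℝ) : ℝ :=
  ∑ i, ∑ j, overlap U V i j * (p i * q j / (p i + t * q j))

/-- Completing the square: with s = tq and y = z - x, (p|x|² + s|y|²)(p + s) - ps|x + y|² = |px -
sy|² ≥ 0. The case p = 0 is separate because p + tq may then vanish. -/
theorem parallel_sum_le {p q t : ℝ} (hp : 0 ≤ p) (hq : 0 ≤ q) (ht : 0 < t) (x z : ℂ) :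
    Complex.normSq z * (p * q / (p + t * q)) ≤
      t⁻¹ * (p * Complex.normSq x) + q * Complex.normSq (z - x) := by
  rcases hp.eq_or_lt with rfl | hp'
  · simp only [zero_mul, zero_div, mul_zero, zero_add]
    exact mul_nonneg hq (Complex.normSq_nonneg _)
  have h : 0 < p + t * q := by positivity
  rw [mul_div_assoc', div_le_iff₀ h, ← mul_le_mul_iff_right₀ ht]
  have e : t * ((t⁻¹ * (p * Complex.normSq x) + q * Complex.normSq (z - x)) * (p + t * q)) =
      (p * Complex.normSq x + t * q * Complex.normSq (z - x)) * (p + t * q) := by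
    field_simp
  rw [e]
  simp only [Complex.normSq_apply, Complex.sub_re, Complex.sub_im]
  nlinarith [sq_nonneg (p * x.re - t * q * (z.re - x.re)),
    sq_nonneg (p * x.im - t * q * (z.im - x.im))]

/-- The square in `parallel_sum_le` vanishes when px = tq(z - x), which gives this value of x. If p
= q = 0, the convention 0/0 = 0 makes both sides zero. -/
theorem parallel_sum_eq {p q t : ℝ} (hp : 0 ≤ p) (hq : 0 ≤ q) (ht : 0 < t) (z : ℂ) :
    t⁻¹ * (p * Complex.normSq ((t * q / (p + t * q) : ℝ) * z)) +
        q * Complex.normSq (z - (t * q / (p + t * q) : ℝ) * z) =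
      Complex.normSq z * (p * q / (p + t * q)) := by
  rcases hp.eq_or_lt with rfl | hp'
  · rcases hq.eq_or_lt with rfl | hq'
    · simp
    · simp [(mul_pos ht hq').ne']
  have h : 0 < p + t * q := by positivity
  have e : z - (t * q / (p + t * q) : ℝ) * z = ((p / (p + t * q) : ℝ) : ℂ) * z := by
    have : p / (p + t * q) = 1 - t * q / (p + t * q) := by field_simp; ring
    rw [this]; push_cast; ring
  rw [e]
  simp only [Complex.normSq_mul, Complex.normSq_ofReal]
  field_simp
  ring

variable [DecidableEq n] {ρ U : Matrix n n ℂ} {p : n → ℝ} {σ V : Matrix n n ℂ} {q : n → ℝ}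

/-- In the bases U and V both traces become sums over matrix entries, so the scalar inequality
applies to each entry. With `exists_quasiEntropy_eq` this is a variational formula free of
eigenbases, the form in which channels can be handled. -/
theorem quasiEntropy_le (h : IsDiagonalization ρ U p) (h' : IsDiagonalization σ V q)
    (hp : ∀ i, 0 ≤ p i) (hq : ∀ i, 0 ≤ q i) {t : ℝ} (ht : 0 < t) (X : Matrix n n ℂ) :
    quasiEntropy U p V q t ≤
      t⁻¹ * (Xᴴ * ρ * X).trace.re + ((1 - X) * σ * (1 - X)ᴴ).trace.re := by
  rw [h.trace_conj_left h'.mul_conjTranspose_self, h'.trace_conj_right h.mul_conjTranspose_self,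
    quasiEntropy]
  simp only [Finset.mul_sum, ← Finset.sum_add_distrib]
  refine Finset.sum_le_sum fun i _ => Finset.sum_le_sum fun j _ => ?_
  rw [mul_sub Uᴴ, sub_mul, mul_one, Matrix.sub_apply]
  exact parallel_sum_le (hp i) (hq j) ht _ _

theorem exists_quasiEntropy_eq (h : IsDiagonalization ρ U p) (h' : IsDiagonalization σ V q)
    (hp : ∀ i, 0 ≤ p i) (hq : ∀ i, 0 ≤ q i) {t : ℝ} (ht : 0 < t) :
    ∃ X : Matrix n n ℂ, quasiEntropy U p V q t =
      t⁻¹ * (Xᴴ * ρ * X).trace.re + ((1 - X) * σ * (1 - X)ᴴ).trace.re := by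
  -- The entrywise minimiser from `parallel_sum_eq`, written between the eigenbases of σ and ρ.
  let Y : Matrix n n ℂ := of fun i j => ((t * q j / (p i + t * q j) : ℝ) : ℂ) * (Uᴴ * V) i j
  refine ⟨U * Y * Vᴴ, ?_⟩
  have e : Uᴴ * (U * Y * Vᴴ) * V = Y := by
    rw [mul_assoc, mul_assoc, h'.conjTranspose_mul_self, mul_one, ← mul_assoc,
      h.conjTranspose_mul_self, one_mul]
  rw [h.trace_conj_left h'.mul_conjTranspose_self, h'.trace_conj_right h.mul_conjTranspose_self,
    quasiEntropy]
  simp only [Finset.mul_sum, ← Finset.sum_add_distrib]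
  refine Finset.sum_congr rfl fun i _ => Finset.sum_congr rfl fun j _ => ?_
  rw [mul_sub Uᴴ, sub_mul, mul_one, Matrix.sub_apply, e]
  exact (parallel_sum_eq (hp i) (hq j) ht _).symm

theorem quasiEntropy_le_of_forall_exists {m : Type*} [Fintype m] [DecidableEq m]
    {ρ' U' σ' V' : Matrix m m ℂ} {p' q' : m → ℝ}
    (h : IsDiagonalization ρ U p) (h' : IsDiagonalization σ V q)
    (hp : ∀ i, 0 ≤ p i) (hq : ∀ i, 0 ≤ q i)
    (k : IsDiagonalization ρ' U' p') (k' : IsDiagonalization σ' V' q')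
    (hp' : ∀ i, 0 ≤ p' i) (hq' : ∀ i, 0 ≤ q' i)
    (H : ∀ X' : Matrix m m ℂ, ∃ X : Matrix n n ℂ,
      (Xᴴ * ρ * X).trace.re ≤ (X'ᴴ * ρ' * X').trace.re ∧
      ((1 - X) * σ * (1 - X)ᴴ).trace.re ≤ ((1 - X') * σ' * (1 - X')ᴴ).trace.re)
    {t : ℝ} (ht : 0 < t) : quasiEntropy U p V q t ≤ quasiEntropy U' p' V' q' t := by
  obtain ⟨X', hX'⟩ := exists_quasiEntropy_eq k k' hp' hq' ht
  obtain ⟨X, h1, h2⟩ := H X'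
  rw [hX']
  refine (quasiEntropy_le h h' hp hq ht X).trans (add_le_add ?_ h2)
  exact mul_le_mul_of_nonneg_left h1 (inv_nonneg.mpr ht.le)

end RelativeEntropy

/-! ### From parallel sums to relative entropy, for weighted sums of scalars -/

section ClassicalComparison

open Filter Topology

variable {κ : Type*} [Fintype κ] {w p q : κ → ℝ}

theorem hasDerivAt_mul_log_add_mul {p q t : ℝ} (hp : 0 ≤ p) (hq : 0 ≤ q) (ht : 0 ≤ t) :
    HasDerivAt (fun t => p * Real.log (p + t * q)) (p * q / (p + t * q)) t := by
  rcases hp.eq_or_lt with rfl | hp'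
  · simpa using hasDerivAt_const t (0 : ℝ)
  have h : p + t * q ≠ 0 := by positivity
  have := (((hasDerivAt_mul_const (x := t) q).const_add p).log h).const_mul p
  rwa [← mul_div_assoc] at this

theorem hasDerivAt_sum_mul_log (hp : ∀ k, 0 ≤ p k) (hq : ∀ k, 0 ≤ q k) {t : ℝ} (ht : 0 ≤ t) :
    HasDerivAt (fun t => ∑ k, w k * (p k * Real.log (p k + t * q k) - p k * Real.log (p k)))
      (∑ k, w k * (p k * q k / (p k + t * q k))) t := by
  refine HasDerivAt.fun_sum fun k _ => HasDerivAt.const_mul (w k) ?_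
  exact (hasDerivAt_mul_log_add_mul (hp k) (hq k) ht).sub_const _

theorem tendsto_log_add_mul_sub_log {q : ℝ} (p : ℝ) (hq : 0 < q) :
    Tendsto (fun t => Real.log (p + t * q) - Real.log t) atTop (𝓝 (Real.log q)) := by
  have h : Tendsto (fun t => Real.log (p * t⁻¹ + q)) atTop (𝓝 (Real.log q)) := by
    have := ((tendsto_inv_atTop_zero (𝕜 := ℝ)).const_mul p).add_const q
    rw [mul_zero, zero_add] at this
    exact this.log hq.ne'
  have h2 : Tendsto (fun t => p + t * q) atTop atTop :=
    tendsto_atTop_add_const_left _ _ (tendsto_id.atTop_mul_const hq)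
  refine h.congr' ?_
  filter_upwards [eventually_gt_atTop 0, h2.eventually_gt_atTop 0] with t ht ht2
  rw [← Real.log_div ht2.ne' ht.ne']
  congr 1
  field_simp

/-- Termwise, log(p + tq) - log t tends to log q when q > 0. When q = 0 the support condition `h0`
kills the term, so the convention log 0 = 0 is harmless. -/
theorem tendsto_sum_mul_log (h0 : ∀ k, q k = 0 → w k * p k = 0) (hq : ∀ k, 0 ≤ q k) :
    Tendsto (fun t => ∑ k, w k * (p k * Real.log (p k + t * q k) - p k * Real.log (p k)) -
        (∑ k, w k * p k) * Real.log t) atTop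
      (𝓝 (-∑ k, w k * (p k * (Real.log (p k) - Real.log (q k))))) := by
  simp only [Finset.sum_mul, ← Finset.sum_sub_distrib, ← Finset.sum_neg_distrib]
  refine tendsto_finsetSum _ fun k _ => ?_
  have e : ∀ t, w k * (p k * Real.log (p k + t * q k) - p k * Real.log (p k)) -
      w k * p k * Real.log t =
      (w k * p k) * (Real.log (p k + t * q k) - Real.log t - Real.log (p k)) := fun t => by ring
  simp only [e]
  rw [show -(w k * (p k * (Real.log (p k) - Real.log (q k)))) =
    (w k * p k) * (Real.log (q k) - Real.log (p k)) by ring]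
  rcases (hq k).eq_or_lt with h | h
  · simp [h0 k h.symm]
  · exact ((tendsto_log_add_mul_sub_log (p k) h).sub_const _).const_mul _

/-- The difference of the two functions F of t vanishes at 0 and is nondecreasing by `H`. Passing to
the limit at infinity compares the relative entropies; the log t terms cancel because the total
masses agree (`hs`). -/
theorem sum_mul_log_sub_log_le {κ' : Type*} [Fintype κ'] {w' p' q' : κ' → ℝ}
    (hp : ∀ k, 0 ≤ p k) (hq : ∀ k, 0 ≤ q k) (h0 : ∀ k, q k = 0 → w k * p k = 0)
    (hp' : ∀ k, 0 ≤ p' k) (hq' : ∀ k, 0 ≤ q' k) (h0' : ∀ k, q' k = 0 → w' k * p' k = 0)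
    (hs : ∑ k, w k * p k = ∑ k, w' k * p' k)
    (H : ∀ t : ℝ, 0 < t → ∑ k, w k * (p k * q k / (p k + t * q k)) ≤
      ∑ k, w' k * (p' k * q' k / (p' k + t * q' k))) :
    ∑ k, w' k * (p' k * (Real.log (p' k) - Real.log (q' k))) ≤
      ∑ k, w k * (p k * (Real.log (p k) - Real.log (q k))) := by
  rw [← neg_le_neg_iff]
  refine le_of_tendsto_of_tendsto (tendsto_sum_mul_log h0 hq) (tendsto_sum_mul_log h0' hq') ?_
  have hd := fun (t : ℝ) (ht : 0 ≤ t) =>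
    (hasDerivAt_sum_mul_log (w := w') hp' hq' ht).sub (hasDerivAt_sum_mul_log (w := w) hp hq ht)
  have hm := monotoneOn_of_deriv_nonneg (convex_Ici (0 : ℝ))
    (fun t ht => (hd t ht).continuousAt.continuousWithinAt)
    (fun t ht => (hd t (interior_subset ht)).differentiableAt.differentiableWithinAt)
    (fun t ht => by
      rw [interior_Ici] at ht
      rw [(hd t (le_of_lt ht)).deriv]
      exact sub_nonneg.mpr (H t ht))
  filter_upwards [eventually_ge_atTop 0] with t ht
  have := hm (Set.self_mem_Ici) ht ht
  simp only [Pi.sub_apply, zero_mul, add_zero, sub_self, mul_zero, Finset.sum_const_zero] at this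
  rw [hs]
  linarith

/-- Klein's inequality: log(q/p) ≤ q/p - 1, multiplied by p, for each term. -/
theorem sum_mul_sub_le (hw : ∀ k, 0 ≤ w k) (hp : ∀ k, 0 ≤ p k) (hq : ∀ k, 0 ≤ q k)
    (h0 : ∀ k, q k = 0 → w k * p k = 0) :
    ∑ k, w k * p k - ∑ k, w k * q k ≤
      ∑ k, w k * (p k * (Real.log (p k) - Real.log (q k))) := by
  rw [← Finset.sum_sub_distrib]
  refine Finset.sum_le_sum fun k _ => ?_
  rcases (hq k).eq_or_lt with h | h
  · rw [← mul_assoc, h0 k h.symm, ← h]; simp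
  rw [← mul_sub]
  refine mul_le_mul_of_nonneg_left ?_ (hw k)
  rcases (hp k).eq_or_lt with h' | h'
  · rw [← h']; simpa using h.le
  have := Real.log_le_sub_one_of_pos (div_pos h h')
  rw [Real.log_div h.ne' h'.ne'] at this
  have h2 := mul_le_mul_of_nonneg_left this h'.le
  rw [mul_sub, mul_sub, mul_one, mul_div_cancel₀ _ h'.ne'] at h2
  linarith

end ClassicalComparison

/-! ### Relative entropy: overlaps, support conditions, monotonicity -/

section RelativeEntropy

open Matrix

variable {n : Type*} [Fintype n]

/-- The relative entropy `Tr ρ (log ρ - log σ)`, in nats, of `ρ = U diag(p) U*` with respect to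
`σ = V diag(q) V*`. -/
noncomputable def relativeEntropy (U : Matrix n n ℂ) (p : n → ℝ) (V : Matrix n n ℂ) (q : n → ℝ) :
    ℝ :=
  ∑ k : n × n, overlap U V k.1 k.2 * (p k.1 * (Real.log (p k.1) - Real.log (q k.2)))

theorem overlap_comm (U V : Matrix n n ℂ) (i j : n) : overlap U V i j = overlap V U j i := by
  rw [overlap, overlap, show Uᴴ * V = (Vᴴ * U)ᴴ by simp, conjTranspose_apply, Complex.star_def,
    Complex.normSq_conj]

variable [DecidableEq n] {ρ U : Matrix n n ℂ} {p : n → ℝ} {σ V : Matrix n n ℂ} {q : n → ℝ}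

theorem sum_overlap_right (hU : Uᴴ * U = 1) (hV : V * Vᴴ = 1) (i : n) :
    ∑ j, overlap U V i j = 1 := by
  have h : (Uᴴ * V) * (Uᴴ * V)ᴴ = 1 := by
    rw [conjTranspose_mul, conjTranspose_conjTranspose, mul_assoc, ← mul_assoc V, hV, one_mul, hU]
  have h' := congrArg Complex.re (congrFun (congrFun h i) i)
  rw [mul_apply, Complex.re_sum, one_apply_eq, Complex.one_re] at h'
  rw [← h']
  refine Finset.sum_congr rfl fun j _ => ?_
  rw [conjTranspose_apply, Complex.star_def, Complex.mul_conj, Complex.ofReal_re, overlap]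

theorem sum_overlap_left (hU : U * Uᴴ = 1) (hV : Vᴴ * V = 1) (j : n) :
    ∑ i, overlap U V i j = 1 := by
  simp only [overlap_comm U V]
  exact sum_overlap_right hV hU j

theorem IsDiagonalization.re_conj_apply (h : IsDiagonalization ρ U p) (V : Matrix n n ℂ) (j : n) :
    ((Vᴴ * ρ * V) j j).re = ∑ i, overlap U V i j * p i := by
  have e : Vᴴ * ρ * V = (Uᴴ * V)ᴴ * diagonal (fun i => (p i : ℂ)) * (Uᴴ * V) := by
    conv_lhs => rw [h.2]
    simp only [conjTranspose_mul, conjTranspose_conjTranspose, mul_assoc]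
  rw [e, mul_apply, Complex.re_sum]
  refine Finset.sum_congr rfl fun i _ => ?_
  rw [mul_diagonal, conjTranspose_apply, mul_right_comm, Complex.star_def,
    ← Complex.normSq_eq_conj_mul_self, ← Complex.ofReal_mul, Complex.ofReal_re, overlap]

/-- Summing the overlaps over one basis separates Tr ρ log ρ from Tr ρ log σ; the latter only sees
the diagonal of ρ in the basis V. -/
theorem relativeEntropy_eq (h : IsDiagonalization ρ U p) (hV : V * Vᴴ = 1) :
    relativeEntropy U p V q =
      -∑ i, Real.negMulLog (p i) - ∑ j, ((Vᴴ * ρ * V) j j).re * Real.log (q j) := by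
  simp only [relativeEntropy, mul_sub, Finset.sum_sub_distrib]
  congr 1
  · rw [Fintype.sum_prod_type, ← Finset.sum_neg_distrib]
    refine Finset.sum_congr rfl fun i _ => ?_
    dsimp only
    rw [← Finset.sum_mul, sum_overlap_right h.conjTranspose_mul_self hV, Real.negMulLog]
    ring
  · rw [Fintype.sum_prod_type_right]
    refine Finset.sum_congr rfl fun j _ => ?_
    rw [h.re_conj_apply, Finset.sum_mul]
    simp only [mul_assoc]

theorem sum_overlap_mul_left (h : IsDiagonalization ρ U p) (hV : V * Vᴴ = 1) :
    ∑ k : n × n, overlap U V k.1 k.2 * p k.1 = ρ.trace.re := by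
  rw [Fintype.sum_prod_type, ← h.sum_eigenvalues]
  refine Finset.sum_congr rfl fun i _ => ?_
  dsimp only
  rw [← Finset.sum_mul, sum_overlap_right h.conjTranspose_mul_self hV, one_mul]

theorem sum_overlap_mul_right (hU : U * Uᴴ = 1) (h' : IsDiagonalization σ V q) :
    ∑ k : n × n, overlap U V k.1 k.2 * q k.2 = σ.trace.re := by
  rw [Fintype.sum_prod_type_right, ← h'.sum_eigenvalues]
  refine Finset.sum_congr rfl fun j _ => ?_
  dsimp only
  rw [← Finset.sum_mul, sum_overlap_left hU h'.conjTranspose_mul_self, one_mul]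

/-- A diagonal entry of V*ρV is a sum of nonnegative terms w p, so if it vanishes each term does.
Hypothesis `h0` is the matrix form of supp ρ ⊆ supp σ. -/
theorem overlap_mul_eq_zero (h : IsDiagonalization ρ U p) (hp : ∀ i, 0 ≤ p i)
    (h0 : ∀ j, q j = 0 → ((Vᴴ * ρ * V) j j).re = 0) (k : n × n) (hk : q k.2 = 0) :
    overlap U V k.1 k.2 * p k.1 = 0 := by
  have h1 := h0 k.2 hk
  rw [h.re_conj_apply] at h1
  exact (Finset.sum_eq_zero_iff_of_nonneg fun i _ =>
    mul_nonneg (overlap_nonneg U V i k.2) (hp i)).mp h1 k.1 (Finset.mem_univ _)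

/-- `H` compares the variational formulas at every t > 0, and the scalar comparison turns this into
an inequality of relative entropies. It is used twice: for a channel, and for a fixed ρ with two
ordered second arguments. -/
theorem relativeEntropy_le_of_forall_exists {m : Type*} [Fintype m] [DecidableEq m]
    {ρ' U' σ' V' : Matrix m m ℂ} {p' q' : m → ℝ}
    (h : IsDiagonalization ρ U p) (h' : IsDiagonalization σ V q)
    (hp : ∀ i, 0 ≤ p i) (hq : ∀ i, 0 ≤ q i)
    (h0 : ∀ j, q j = 0 → ((Vᴴ * ρ * V) j j).re = 0)
    (k : IsDiagonalization ρ' U' p') (k' : IsDiagonalization σ' V' q')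
    (hp' : ∀ i, 0 ≤ p' i) (hq' : ∀ i, 0 ≤ q' i)
    (h0' : ∀ j, q' j = 0 → ((V'ᴴ * ρ' * V') j j).re = 0)
    (htr : ρ.trace.re = ρ'.trace.re)
    (H : ∀ X' : Matrix m m ℂ, ∃ X : Matrix n n ℂ,
      (Xᴴ * ρ * X).trace.re ≤ (X'ᴴ * ρ' * X').trace.re ∧
      ((1 - X) * σ * (1 - X)ᴴ).trace.re ≤ ((1 - X') * σ' * (1 - X')ᴴ).trace.re) :
    relativeEntropy U' p' V' q' ≤ relativeEntropy U p V q := by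
  refine sum_mul_log_sub_log_le (fun k => hp k.1) (fun k => hq k.2) (overlap_mul_eq_zero h hp h0)
    (fun k => hp' k.1) (fun k => hq' k.2) (overlap_mul_eq_zero k hp' h0') ?_ fun t ht => ?_
  · rw [sum_overlap_mul_left h h'.mul_conjTranspose_self,
      sum_overlap_mul_left k k'.mul_conjTranspose_self, htr]
  · have := quasiEntropy_le_of_forall_exists h h' hp hq k k' hp' hq' H ht
    simpa only [quasiEntropy, Fintype.sum_prod_type] using this

theorem trace_sub_trace_le_relativeEntropy (h : IsDiagonalization ρ U p)
    (h' : IsDiagonalization σ V q) (hp : ∀ i, 0 ≤ p i) (hq : ∀ i, 0 ≤ q i)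
    (h0 : ∀ j, q j = 0 → ((Vᴴ * ρ * V) j j).re = 0) :
    ρ.trace.re - σ.trace.re ≤ relativeEntropy U p V q := by
  rw [← sum_overlap_mul_left h h'.mul_conjTranspose_self,
    ← sum_overlap_mul_right h.mul_conjTranspose_self h']
  exact sum_mul_sub_le (fun k => overlap_nonneg U V k.1 k.2) (fun k => hp k.1) (fun k => hq k.2)
    (overlap_mul_eq_zero h hp h0)

end RelativeEntropy

/-! ### Relative entropy with respect to products of marginals -/

section Marginals

open Matrix Kronecker

theorem trace_mul_kronecker_one {a b : Type*} [Fintype a] [Fintype b] [DecidableEq b]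
    (ρ : Matrix (a × b) (a × b) ℂ) (A : Matrix a a ℂ) :
    (ρ * A ⊗ₖ (1 : Matrix b b ℂ)).trace = (marginalFst ρ * A).trace := by
  simp only [trace, diag, mul_apply, Fintype.sum_prod_type, kroneckerMap_apply, marginalFst,
    of_apply, one_apply, mul_ite, mul_one, mul_zero, Finset.sum_ite_eq', Finset.mem_univ, if_true,
    Finset.sum_mul]
  refine Finset.sum_congr rfl fun i _ => ?_
  rw [Finset.sum_comm]

theorem trace_mul_one_kronecker {a b : Type*} [Fintype a] [DecidableEq a] [Fintype b]
    (ρ : Matrix (a × b) (a × b) ℂ) (B : Matrix b b ℂ) :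
    (ρ * (1 : Matrix a a ℂ) ⊗ₖ B).trace = (marginalSnd ρ * B).trace := by
  simp only [trace, diag, mul_apply, Fintype.sum_prod_type_right, kroneckerMap_apply, marginalSnd,
    of_apply, one_apply, ite_mul, one_mul, zero_mul, mul_ite, mul_zero, Finset.sum_ite_eq',
    Finset.mem_univ, if_true, Finset.sum_mul]
  refine Finset.sum_congr rfl fun i _ => ?_
  rw [Finset.sum_comm]

theorem trace_mul_single_one {n : Type*} [Fintype n] [DecidableEq n] (M : Matrix n n ℂ) (i : n) :
    (M * single i i 1).trace = M i i := by
  simp [trace_mul_single]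

variable {a b : Type*} [Fintype a] [DecidableEq a] [Fintype b] [DecidableEq b]

/-- The partial trace is adjoint to A ↦ A ⊗ 1, and conjugating a matrix unit tensored with 1 by U ⊗
V leaves the second factor 1, since V is unitary. -/
theorem sum_conj_kronecker_fst (ρ : Matrix (a × b) (a × b) ℂ) (U : Matrix a a ℂ)
    {V : Matrix b b ℂ} (hV : V * Vᴴ = 1) (i : a) :
    ∑ j, ((U ⊗ₖ V)ᴴ * ρ * (U ⊗ₖ V)) (i, j) (i, j) = (Uᴴ * marginalFst ρ * U) i i := by
  have e : (U ⊗ₖ V) * (single i i (1 : ℂ) ⊗ₖ (1 : Matrix b b ℂ)) * (U ⊗ₖ V)ᴴ =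
      (U * single i i (1 : ℂ) * Uᴴ) ⊗ₖ (1 : Matrix b b ℂ) := by
    rw [conjTranspose_kronecker, ← mul_kronecker_mul, ← mul_kronecker_mul, mul_one, hV]
  calc ∑ j, ((U ⊗ₖ V)ᴴ * ρ * (U ⊗ₖ V)) (i, j) (i, j)
      = marginalFst ((U ⊗ₖ V)ᴴ * ρ * (U ⊗ₖ V)) i i := rfl
    _ = (ρ * ((U ⊗ₖ V) * (single i i (1 : ℂ) ⊗ₖ (1 : Matrix b b ℂ)) * (U ⊗ₖ V)ᴴ)).trace := by
      rw [← trace_mul_single_one (marginalFst _), ← trace_mul_kronecker_one, mul_assoc, mul_assoc,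
        trace_mul_comm, mul_assoc]
    _ = (Uᴴ * marginalFst ρ * U) i i := by
      rw [e, trace_mul_kronecker_one, ← mul_assoc, trace_mul_comm,
        ← trace_mul_single_one (Uᴴ * marginalFst ρ * U), ← mul_assoc, ← mul_assoc]

theorem sum_conj_kronecker_snd (ρ : Matrix (a × b) (a × b) ℂ) {U : Matrix a a ℂ}
    (hU : U * Uᴴ = 1) (V : Matrix b b ℂ) (j : b) :
    ∑ i, ((U ⊗ₖ V)ᴴ * ρ * (U ⊗ₖ V)) (i, j) (i, j) = (Vᴴ * marginalSnd ρ * V) j j := by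
  have e : (U ⊗ₖ V) * ((1 : Matrix a a ℂ) ⊗ₖ single j j (1 : ℂ)) * (U ⊗ₖ V)ᴴ =
      (1 : Matrix a a ℂ) ⊗ₖ (V * single j j (1 : ℂ) * Vᴴ) := by
    rw [conjTranspose_kronecker, ← mul_kronecker_mul, ← mul_kronecker_mul, mul_one, hU]
  calc ∑ i, ((U ⊗ₖ V)ᴴ * ρ * (U ⊗ₖ V)) (i, j) (i, j)
      = marginalSnd ((U ⊗ₖ V)ᴴ * ρ * (U ⊗ₖ V)) j j := rfl
    _ = (ρ * ((U ⊗ₖ V) * ((1 : Matrix a a ℂ) ⊗ₖ single j j (1 : ℂ)) * (U ⊗ₖ V)ᴴ)).trace := by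
      rw [← trace_mul_single_one (marginalSnd _), ← trace_mul_one_kronecker, mul_assoc, mul_assoc,
        trace_mul_comm, mul_assoc]
    _ = (Vᴴ * marginalSnd ρ * V) j j := by
      rw [e, trace_mul_one_kronecker, ← mul_assoc, trace_mul_comm,
        ← trace_mul_single_one (Vᴴ * marginalSnd ρ * V), ← mul_assoc, ← mul_assoc]

variable {ρ : Matrix (a × b) (a × b) ℂ} {U : Matrix a a ℂ} {p : a → ℝ} {V : Matrix b b ℂ}
  {q : b → ℝ}

theorem IsDiagonalization.conj_apply {n : Type*} [Fintype n] [DecidableEq n] {ρ U : Matrix n n ℂ}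
    {p : n → ℝ} (h : IsDiagonalization ρ U p) (i : n) : (Uᴴ * ρ * U) i i = p i := by
  conv_lhs => rw [h.2]
  rw [← mul_assoc, ← mul_assoc, h.conjTranspose_mul_self, one_mul, mul_assoc,
    h.conjTranspose_mul_self, mul_one, diagonal_apply_eq]

theorem re_conj_apply_nonneg {n : Type*} [Fintype n] {ρ : Matrix n n ℂ}
    (hρ : ρ.PosSemidef) (U : Matrix n n ℂ) (i : n) : 0 ≤ ((Uᴴ * ρ * U) i i).re :=
  (Complex.le_def.mp (hρ.conjTranspose_mul_mul_same U).diag_nonneg).1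

/-- The diagonal entries are nonnegative and add up to the eigenvalue p i = 0. This is the support
condition of ρ with respect to the product of its marginals. -/
theorem conj_kronecker_eq_zero_fst (hρ : ρ.PosSemidef) (h : IsDiagonalization (marginalFst ρ) U p)
    (hV : V * Vᴴ = 1) (i : a) (hi : p i = 0) (j : b) :
    (((U ⊗ₖ V)ᴴ * ρ * (U ⊗ₖ V)) (i, j) (i, j)).re = 0 := by
  have := congrArg Complex.re (sum_conj_kronecker_fst ρ U hV i)
  rw [h.conj_apply, hi, Complex.ofReal_zero, Complex.zero_re, Complex.re_sum] at this
  exact (Finset.sum_eq_zero_iff_of_nonneg fun j _ => re_conj_apply_nonneg hρ _ _).mp this j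
    (Finset.mem_univ _)

theorem conj_kronecker_eq_zero_snd (hρ : ρ.PosSemidef) (hU : U * Uᴴ = 1)
    (h : IsDiagonalization (marginalSnd ρ) V q) (j : b) (hj : q j = 0) (i : a) :
    (((U ⊗ₖ V)ᴴ * ρ * (U ⊗ₖ V)) (i, j) (i, j)).re = 0 := by
  have := congrArg Complex.re (sum_conj_kronecker_snd ρ hU V j)
  rw [h.conj_apply, hj, Complex.ofReal_zero, Complex.zero_re, Complex.re_sum] at this
  exact (Finset.sum_eq_zero_iff_of_nonneg fun j _ => re_conj_apply_nonneg hρ _ _).mp this i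
    (Finset.mem_univ _)

theorem conj_kronecker_eq_zero (hρ : ρ.PosSemidef) (h : IsDiagonalization (marginalFst ρ) U p)
    (h' : IsDiagonalization (marginalSnd ρ) V q) (k : a × b) (hk : p k.1 * q k.2 = 0) :
    (((U ⊗ₖ V)ᴴ * ρ * (U ⊗ₖ V)) k k).re = 0 := by
  rcases mul_eq_zero.mp hk with hk | hk
  · exact conj_kronecker_eq_zero_fst hρ h h'.mul_conjTranspose_self k.1 hk k.2
  · exact conj_kronecker_eq_zero_snd hρ h.mul_conjTranspose_self h' k.2 hk k.1

theorem sum_conj_kronecker_mul_log_fst (h : IsDiagonalization (marginalFst ρ) U p)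
    (hV : V * Vᴴ = 1) :
    ∑ k : a × b, (((U ⊗ₖ V)ᴴ * ρ * (U ⊗ₖ V)) k k).re * Real.log (p k.1) =
      -∑ i, Real.negMulLog (p i) := by
  rw [Fintype.sum_prod_type, ← Finset.sum_neg_distrib]
  refine Finset.sum_congr rfl fun i _ => ?_
  dsimp only
  rw [← Finset.sum_mul, ← Complex.re_sum, sum_conj_kronecker_fst ρ U hV, h.conj_apply,
    Real.negMulLog, Complex.ofReal_re]
  ring

theorem sum_conj_kronecker_mul_log_snd (hU : U * Uᴴ = 1)
    (h : IsDiagonalization (marginalSnd ρ) V q) :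
    ∑ k : a × b, (((U ⊗ₖ V)ᴴ * ρ * (U ⊗ₖ V)) k k).re * Real.log (q k.2) =
      -∑ j, Real.negMulLog (q j) := by
  rw [Fintype.sum_prod_type_right, ← Finset.sum_neg_distrib]
  refine Finset.sum_congr rfl fun j _ => ?_
  dsimp only
  rw [← Finset.sum_mul, ← Complex.re_sum, sum_conj_kronecker_snd ρ hU V, h.conj_apply,
    Real.negMulLog, Complex.ofReal_re]
  ring

/-- `D(ρ_{AB} ‖ ρ_A ⊗ ρ_B) = I(A;B)_ρ` (in nats). -/
theorem relativeEntropy_marginals {W : Matrix (a × b) (a × b) ℂ} {s : a × b → ℝ}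
    (hρ : ρ.PosSemidef) (hW : IsDiagonalization ρ W s)
    (h : IsDiagonalization (marginalFst ρ) U p) (h' : IsDiagonalization (marginalSnd ρ) V q) :
    relativeEntropy W s (U ⊗ₖ V) (fun k => p k.1 * q k.2) =
      mutualInformation ρ * Real.log 2 := by
  rw [mutualInformation, h.vonNeumannEntropy_eq, h'.vonNeumannEntropy_eq, hW.vonNeumannEntropy_eq,
    ← add_div, ← sub_div, div_mul_cancel₀ _ (Real.log_pos one_lt_two).ne',
    relativeEntropy_eq hW (h.kronecker h').mul_conjTranspose_self]
  have e : ∀ k : a × b, (((U ⊗ₖ V)ᴴ * ρ * (U ⊗ₖ V)) k k).re * Real.log (p k.1 * q k.2) =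
      (((U ⊗ₖ V)ᴴ * ρ * (U ⊗ₖ V)) k k).re * Real.log (p k.1) +
      (((U ⊗ₖ V)ᴴ * ρ * (U ⊗ₖ V)) k k).re * Real.log (q k.2) := by
    intro k
    -- The logarithm of the product splits only for nonzero factors; otherwise the diagonal entry of
    -- ρ is zero.
    by_cases hk : p k.1 * q k.2 = 0
    · rw [conj_kronecker_eq_zero hρ h h' k hk]; simp
    · rw [Real.log_mul (left_ne_zero_of_mul hk) (right_ne_zero_of_mul hk), mul_add]
  simp only [e, Finset.sum_add_distrib]
  rw [sum_conj_kronecker_mul_log_fst h h'.mul_conjTranspose_self,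
    sum_conj_kronecker_mul_log_snd h.mul_conjTranspose_self h']
  ring

end Marginals

/-! ### Kraus operators and the Schwarz inequality -/

theorem linearMap_apply_eq_sum {m n : Type*} [Fintype m] [DecidableEq m]
    (Θ : Matrix m m ℂ →ₗ[ℂ] Matrix n n ℂ) (Y : Matrix m m ℂ) (p q : n) :
    Θ Y p q = ∑ i, ∑ j, Y i j * Θ (Matrix.single i j 1) p q := by
  conv_lhs => rw [Matrix.matrix_eq_sum_single Y]
  simp only [map_sum, Matrix.sum_apply]
  refine Finset.sum_congr rfl fun i _ => Finset.sum_congr rfl fun j _ => ?_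
  rw [show Matrix.single i j (Y i j) = Y i j • Matrix.single i j (1 : ℂ) by
    rw [Matrix.smul_single, smul_eq_mul, mul_one], map_smul, Matrix.smul_apply, smul_eq_mul]

namespace QuantumChannel

open Matrix

variable {a b : Type*} [Fintype a] [Fintype b]

-- Choi's argument: the image of the unnormalised maximally entangled state is positive, hence of
-- the form B*B, and the rows of B, conjugated and reshaped, are Kraus operators. Trace preservation
-- on matrix units gives the completeness relation.
open scoped MatrixOrder Matrix.Norms.L2Operator in
theorem exists_kraus [DecidableEq a] (T : QuantumChannel a b) :
    ∃ K : a × b → Matrix b a ℂ, (∀ X, T.map X = ∑ k, K k * X * (K k)ᴴ) ∧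
      ∑ k, (K k)ᴴ * K k = 1 := by
  classical
  let u : a × a → ℂ := fun x => if x.1 = x.2 then 1 else 0
  have hΩ : (vecMulVec u (star u)).PosSemidef := posSemidef_vecMulVec_self_star u
  have hslice : ∀ i j, (of fun x y => vecMulVec u (star u) (i, x) (j, y)) =
      single i j (1 : ℂ) := by
    intro i j
    ext x y
    by_cases h1 : i = x <;> by_cases h2 : j = y <;> simp [vecMulVec_apply, u, h1, h2]
  obtain ⟨B, hB⟩ := CStarAlgebra.nonneg_iff_eq_star_mul_self.mp
    (nonneg_iff_posSemidef.mpr (T.posSemidef_idTensor a _ hΩ))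
  have hT : ∀ i j p q, T.map (single i j 1) p q = ∑ k, star (B k (i, p)) * B k (j, q) := by
    intro i j p q
    have := congrFun (congrFun hB (i, p)) (j, q)
    rw [mul_apply] at this
    simp only [star_eq_conjTranspose, conjTranspose_apply] at this
    rw [← this, ← hslice]
    rfl
  refine ⟨fun k => of fun p i => star (B k (i, p)), fun X => ?_, ?_⟩
  · ext p q
    rw [linearMap_apply_eq_sum]
    simp only [Matrix.sum_apply, mul_apply, of_apply, conjTranspose_apply, star_star,
      Finset.sum_mul, hT, Finset.mul_sum]
    calc ∑ i, ∑ j, ∑ k, X i j * (star (B k (i, p)) * B k (j, q))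
        = ∑ i, ∑ k, ∑ j, X i j * (star (B k (i, p)) * B k (j, q)) :=
          Finset.sum_congr rfl fun i _ => Finset.sum_comm
      _ = ∑ k, ∑ i, ∑ j, X i j * (star (B k (i, p)) * B k (j, q)) := Finset.sum_comm
      _ = _ := by
        refine Finset.sum_congr rfl fun k _ => ?_
        rw [Finset.sum_comm]
        refine Finset.sum_congr rfl fun j _ => Finset.sum_congr rfl fun i _ => ?_
        ring
  · ext j i
    have h := T.trace_preserving (single i j 1)
    simp only [trace, diag, hT] at h
    simp only [Matrix.sum_apply, mul_apply, of_apply, conjTranspose_apply, star_star]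
    rw [Finset.sum_comm] at h
    have e : ∑ k, ∑ p, B k (j, p) * star (B k (i, p)) =
        ∑ k, ∑ p, star (B k (i, p)) * B k (j, p) :=
      Finset.sum_congr rfl fun k _ => Finset.sum_congr rfl fun p _ => mul_comm _ _
    rw [e, h]
    by_cases hij : i = j
    · subst hij; simp [single_apply]
    · simp [single_apply, one_apply, Ne.symm hij]

theorem map_posSemidef (T : QuantumChannel a b) {X : Matrix a a ℂ}
    (hX : X.PosSemidef) : (T.map X).PosSemidef := by
  classical
  obtain ⟨K, hK, -⟩ := T.exists_kraus
  rw [hK]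
  exact posSemidef_sum _ fun k _ => hX.mul_mul_conjTranspose_same _

theorem map_isDensity (T : QuantumChannel a b) {X : Matrix a a ℂ}
    (hX : IsDensity X) : IsDensity (T.map X) :=
  ⟨T.map_posSemidef hX.1, (T.trace_preserving X).trans hX.2⟩

end QuantumChannel

section Schwarz

open Matrix

variable {a b κ : Type*} [Fintype a] [DecidableEq a] [Fintype b] [Fintype κ]
  {K : κ → Matrix b a ℂ}

/-- The Schwarz inequality for a unital completely positive map, tested on a positive matrix. -/
theorem trace_conj_sum_kraus_le (hK : ∑ k, (K k)ᴴ * K k = 1) {ρ : Matrix a a ℂ}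
    (hρ : ρ.PosSemidef) (Y : Matrix b b ℂ) :
    ((∑ k, (K k)ᴴ * Y * K k)ᴴ * ρ * ∑ k, (K k)ᴴ * Y * K k).trace.re ≤
      (Yᴴ * (∑ k, K k * ρ * (K k)ᴴ) * Y).trace.re := by
  set Z : Matrix a a ℂ := ∑ k, (K k)ᴴ * Y * K k with hZ
  have hZ' : Zᴴ = ∑ k, (K k)ᴴ * Yᴴ * K k := by
    simp only [hZ, conjTranspose_sum, conjTranspose_mul, conjTranspose_conjTranspose,
      Matrix.mul_assoc]
  -- Expanded, the last three kinds of terms each sum to ± Tr Z*ρZ: the two cross terms by the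
  -- definition of Z, the final one by completeness. What remains is the right side minus the left.
  have h0 : 0 ≤ (∑ k, (((K k)ᴴ * Y - Z * (K k)ᴴ)ᴴ * ρ * ((K k)ᴴ * Y - Z * (K k)ᴴ)).trace).re := by
    rw [Complex.re_sum]
    exact Finset.sum_nonneg fun k _ =>
      (Complex.le_def.mp (hρ.conjTranspose_mul_mul_same _).trace_nonneg).1
  have e : ∀ k, (((K k)ᴴ * Y - Z * (K k)ᴴ)ᴴ * ρ * ((K k)ᴴ * Y - Z * (K k)ᴴ)).trace =
      (Yᴴ * (K k * ρ * (K k)ᴴ) * Y).trace - (Zᴴ * ρ * ((K k)ᴴ * Y * K k)).trace -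
        (((K k)ᴴ * Yᴴ * K k) * ρ * Z).trace + (Zᴴ * ρ * Z * ((K k)ᴴ * K k)).trace := by
    intro k
    rw [conjTranspose_sub, conjTranspose_mul, conjTranspose_mul, conjTranspose_conjTranspose,
      Matrix.sub_mul, Matrix.sub_mul, Matrix.mul_sub, Matrix.mul_sub, trace_sub, trace_sub,
      trace_sub]
    have e1 : (K k * Zᴴ * ρ * ((K k)ᴴ * Y)).trace = (Zᴴ * ρ * ((K k)ᴴ * Y * K k)).trace := by
      rw [Matrix.mul_assoc, Matrix.mul_assoc, trace_mul_comm]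
      simp only [Matrix.mul_assoc]
    have e2 : (Yᴴ * K k * ρ * (Z * (K k)ᴴ)).trace = (((K k)ᴴ * Yᴴ * K k) * ρ * Z).trace := by
      rw [← Matrix.mul_assoc, trace_mul_comm]
      simp only [Matrix.mul_assoc]
    have e3 : (K k * Zᴴ * ρ * (Z * (K k)ᴴ)).trace = (Zᴴ * ρ * Z * ((K k)ᴴ * K k)).trace := by
      rw [Matrix.mul_assoc, Matrix.mul_assoc, trace_mul_comm]
      simp only [Matrix.mul_assoc]
    rw [e1, e2, e3, show Yᴴ * K k * ρ * ((K k)ᴴ * Y) = Yᴴ * (K k * ρ * (K k)ᴴ) * Y by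
      simp only [Matrix.mul_assoc]]
    ring
  simp only [e, Finset.sum_add_distrib, Finset.sum_sub_distrib, ← trace_sum, ← Finset.mul_sum,
    ← Finset.sum_mul, ← hZ, ← hZ', hK, mul_one] at h0
  rw [sub_add_cancel, Complex.sub_re] at h0
  linarith

/-- Take X to be the image of X' under the adjoint of T. The adjoint is unital, so 1 - X is the
image of 1 - X', and the Schwarz inequality applies to X' and to (1 - X')*. -/
theorem QuantumChannel.exists_trace_conj_le [DecidableEq b] (T : QuantumChannel a b)
    {ρ σ : Matrix a a ℂ} (hρ : ρ.PosSemidef) (hσ : σ.PosSemidef) (X' : Matrix b b ℂ) :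
    ∃ X : Matrix a a ℂ, (Xᴴ * ρ * X).trace.re ≤ (X'ᴴ * T.map ρ * X').trace.re ∧
      ((1 - X) * σ * (1 - X)ᴴ).trace.re ≤ ((1 - X') * T.map σ * (1 - X')ᴴ).trace.re := by
  obtain ⟨K, hT, hK⟩ := T.exists_kraus
  refine ⟨∑ k, (K k)ᴴ * X' * K k, ?_, ?_⟩
  · rw [hT]
    exact trace_conj_sum_kraus_le hK hρ X'
  · have h := trace_conj_sum_kraus_le hK hσ (1 - X')ᴴ
    have e : ∑ k, (K k)ᴴ * (1 - X')ᴴ * K k = (1 - ∑ k, (K k)ᴴ * X' * K k)ᴴ := by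
      conv_rhs => rw [← hK, ← Finset.sum_sub_distrib, conjTranspose_sum]
      refine Finset.sum_congr rfl fun k _ => ?_
      simp only [conjTranspose_sub, conjTranspose_mul, conjTranspose_conjTranspose, Matrix.mul_sub,
        Matrix.sub_mul, conjTranspose_one, Matrix.mul_one, Matrix.mul_assoc]
    rw [e, conjTranspose_conjTranspose, conjTranspose_conjTranspose, ← hT] at h
    exact h

end Schwarz

/-! ### Marginals and local maps -/

section LocalMaps

open Matrix Kronecker

variable {a b c d r : Type*}

theorem marginalFst_posSemidef [Fintype b] {ρ : Matrix (a × b) (a × b) ℂ} (hρ : ρ.PosSemidef) :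
    (marginalFst ρ).PosSemidef := by
  have : marginalFst ρ = ∑ k, ρ.submatrix (fun i => (i, k)) (fun i => (i, k)) := by
    ext i j
    simp [marginalFst, Matrix.sum_apply]
  rw [this]
  exact posSemidef_sum _ fun k _ => hρ.submatrix _

theorem marginalSnd_posSemidef [Fintype a] {ρ : Matrix (a × b) (a × b) ℂ} (hρ : ρ.PosSemidef) :
    (marginalSnd ρ).PosSemidef := by
  have : marginalSnd ρ = ∑ k, ρ.submatrix (fun i => (k, i)) (fun i => (k, i)) := by
    ext i j
    simp [marginalSnd, Matrix.sum_apply]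
  rw [this]
  exact posSemidef_sum _ fun k _ => hρ.submatrix _

theorem trace_marginalFst [Fintype a] [Fintype b] (ρ : Matrix (a × b) (a × b) ℂ) :
    (marginalFst ρ).trace = ρ.trace := by
  simp only [trace, diag, marginalFst, of_apply, Fintype.sum_prod_type]

theorem trace_marginalSnd [Fintype a] [Fintype b] (ρ : Matrix (a × b) (a × b) ℂ) :
    (marginalSnd ρ).trace = ρ.trace := by
  simp only [trace, diag, marginalSnd, of_apply, Fintype.sum_prod_type_right]

theorem IsDensity.marginalFst [Fintype a] [Fintype b] {ρ : Matrix (a × b) (a × b) ℂ}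
    (hρ : IsDensity ρ) :
    IsDensity (marginalFst ρ) :=
  ⟨marginalFst_posSemidef hρ.1, (trace_marginalFst ρ).trans hρ.2⟩

theorem IsDensity.marginalSnd [Fintype a] [Fintype b] {ρ : Matrix (a × b) (a × b) ℂ}
    (hρ : IsDensity ρ) :
    IsDensity (marginalSnd ρ) :=
  ⟨marginalSnd_posSemidef hρ.1, (trace_marginalSnd ρ).trans hρ.2⟩

theorem IsDensity.submatrix [Fintype a] [Fintype b] {ρ : Matrix a a ℂ}
    (hρ : IsDensity ρ) (e : b ≃ a) :
    IsDensity (ρ.submatrix e e) :=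
  ⟨hρ.1.submatrix e, by rw [← hρ.2]; exact Equiv.sum_comp e fun i => ρ i i⟩

theorem IsDensity.kronecker [Fintype a] [Fintype b] {ρ : Matrix a a ℂ} {σ : Matrix b b ℂ}
    (hρ : IsDensity ρ)
    (hσ : IsDensity σ) : IsDensity (ρ ⊗ₖ σ) :=
  ⟨hρ.1.kronecker hσ.1, by rw [trace_kronecker, hρ.2, hσ.2, one_mul]⟩

theorem marginalSnd_idTensor [Fintype r] (Φ : Matrix a a ℂ →ₗ[ℂ] Matrix b b ℂ)
    (X : Matrix (r × a) (r × a) ℂ) : marginalSnd (idTensor r Φ X) = Φ (marginalSnd X) := by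
  have : marginalSnd X = ∑ k, of fun x y => X (k, x) (k, y) := by
    ext i j
    simp [marginalSnd, Matrix.sum_apply]
  ext i j
  rw [this, map_sum, Matrix.sum_apply]
  rfl

theorem marginalFst_tensorId [Fintype r] (Φ : Matrix a a ℂ →ₗ[ℂ] Matrix b b ℂ)
    (X : Matrix (a × r) (a × r) ℂ) : marginalFst (tensorId Φ r X) = Φ (marginalFst X) := by
  have : marginalFst X = ∑ k, of fun x y => X (x, k) (y, k) := by
    ext i j
    simp [marginalFst, Matrix.sum_apply]
  ext i j
  rw [this, map_sum, Matrix.sum_apply]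
  rfl

theorem marginalFst_idTensor [Fintype a] [Fintype b] {Φ : Matrix a a ℂ →ₗ[ℂ] Matrix b b ℂ}
    (hΦ : ∀ X, (Φ X).trace = X.trace) (X : Matrix (r × a) (r × a) ℂ) :
    marginalFst (idTensor r Φ X) = marginalFst X := by
  ext i j
  exact hΦ (of fun x y => X (i, x) (j, y))

theorem marginalSnd_tensorId [Fintype a] [Fintype b] {Φ : Matrix a a ℂ →ₗ[ℂ] Matrix b b ℂ}
    (hΦ : ∀ X, (Φ X).trace = X.trace) (X : Matrix (a × r) (a × r) ℂ) :
    marginalSnd (tensorId Φ r X) = marginalSnd X := by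
  ext i j
  exact hΦ (of fun x y => X (x, i) (y, j))

theorem idTensor_kronecker (Φ : Matrix a a ℂ →ₗ[ℂ] Matrix b b ℂ) (A : Matrix r r ℂ)
    (B : Matrix a a ℂ) : idTensor r Φ (A ⊗ₖ B) = A ⊗ₖ Φ B := by
  ext p q
  have : (of fun x y => (A ⊗ₖ B) (p.1, x) (q.1, y)) = A p.1 q.1 • B := by
    ext x y
    simp
  change Φ (of fun x y => (A ⊗ₖ B) (p.1, x) (q.1, y)) p.2 q.2 = _
  rw [this, map_smul]
  simp

theorem tensorId_kronecker (Φ : Matrix a a ℂ →ₗ[ℂ] Matrix b b ℂ) (A : Matrix a a ℂ)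
    (B : Matrix r r ℂ) : tensorId Φ r (A ⊗ₖ B) = Φ A ⊗ₖ B := by
  ext p q
  have : (of fun x y => (A ⊗ₖ B) (x, p.2) (y, q.2)) = B p.2 q.2 • A := by
    ext x y
    simp [mul_comm]
  change Φ (of fun x y => (A ⊗ₖ B) (x, p.2) (y, q.2)) p.1 q.1 = _
  rw [this, map_smul]
  simp [mul_comm]

/-- Maps on different factors commute. -/
theorem tensorId_idTensor_comm [Fintype a] (Φ : Matrix a a ℂ →ₗ[ℂ] Matrix b b ℂ)
    (Ψ : Matrix c c ℂ →ₗ[ℂ] Matrix d d ℂ) (X : Matrix (a × c) (a × c) ℂ) :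
    tensorId Φ d (idTensor a Ψ X) = idTensor b Ψ (tensorId Φ c X) := by
  classical
  ext p q
  change Φ (of fun x y => Ψ (of fun z w => X (x, z) (y, w)) p.2 q.2) p.1 q.1 =
    Ψ (of fun z w => Φ (of fun x y => X (x, z) (y, w)) p.1 q.1) p.2 q.2
  have e : (of fun z w => Φ (of fun x y => X (x, z) (y, w)) p.1 q.1) =
      ∑ i, ∑ j, Φ (single i j 1) p.1 q.1 • of fun z w => X (i, z) (j, w) := by
    ext z w
    rw [of_apply, linearMap_apply_eq_sum]
    simp only [Matrix.sum_apply, Matrix.smul_apply, of_apply, smul_eq_mul, mul_comm]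
  rw [e, linearMap_apply_eq_sum]
  simp only [map_sum, map_smul, Matrix.sum_apply, Matrix.smul_apply, of_apply, smul_eq_mul,
    mul_comm]

end LocalMaps

open Matrix Kronecker

/-! ### Tensor products of channels: states, marginals, composition -/

namespace QuantumChannel

variable {a b c : Type*} [Fintype a] [Fintype b] [Fintype c]

theorem idTensor_isDensity (Φ : QuantumChannel a b) {r : Type*} [Fintype r]
    {ρ : Matrix (r × a) (r × a) ℂ} (hρ : IsDensity ρ) : IsDensity (idTensor r Φ.map ρ) := by
  refine ⟨Φ.posSemidef_idTensor r ρ hρ.1, ?_⟩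
  rw [← trace_marginalFst, marginalFst_idTensor Φ.trace_preserving, trace_marginalFst, hρ.2]

variable {a₁ a₂ b₁ b₂ c₁ c₂ : Type*} [Fintype a₁] [Fintype a₂] [Fintype b₁] [Fintype b₂]
  [Fintype c₁] [Fintype c₂]

theorem tensor_map_apply (Φ : QuantumChannel a₁ b₁) (Ψ : QuantumChannel a₂ b₂)
    (X : Matrix (a₁ × a₂) (a₁ × a₂) ℂ) :
    (Φ.tensor Ψ).map X = tensorId Φ.map b₂ (idTensor a₁ Ψ.map X) := rfl

theorem tensor_map_kronecker (Φ : QuantumChannel a₁ b₁) (Ψ : QuantumChannel a₂ b₂)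
    (A : Matrix a₁ a₁ ℂ) (B : Matrix a₂ a₂ ℂ) :
    (Φ.tensor Ψ).map (A ⊗ₖ B) = Φ.map A ⊗ₖ Ψ.map B := by
  rw [tensor_map_apply, idTensor_kronecker, tensorId_kronecker]

theorem marginalFst_tensor_map (Φ : QuantumChannel a₁ b₁) (Ψ : QuantumChannel a₂ b₂)
    (X : Matrix (a₁ × a₂) (a₁ × a₂) ℂ) :
    marginalFst ((Φ.tensor Ψ).map X) = Φ.map (marginalFst X) := by
  rw [tensor_map_apply, marginalFst_tensorId, marginalFst_idTensor Ψ.trace_preserving]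

theorem marginalSnd_tensor_map (Φ : QuantumChannel a₁ b₁) (Ψ : QuantumChannel a₂ b₂)
    (X : Matrix (a₁ × a₂) (a₁ × a₂) ℂ) :
    marginalSnd ((Φ.tensor Ψ).map X) = Ψ.map (marginalSnd X) := by
  rw [tensor_map_apply, marginalSnd_tensorId Φ.trace_preserving, marginalSnd_idTensor]

theorem tensor_map_tensor_map {Φ₁ : QuantumChannel a₁ b₁} {Φ₂ : QuantumChannel a₂ b₂}
    {T₁ : QuantumChannel b₁ c₁} {T₂ : QuantumChannel b₂ c₂}
    {Ψ₁ : QuantumChannel a₁ c₁} {Ψ₂ : QuantumChannel a₂ c₂}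
    (h₁ : ∀ X, T₁.map (Φ₁.map X) = Ψ₁.map X) (h₂ : ∀ X, T₂.map (Φ₂.map X) = Ψ₂.map X)
    (X : Matrix (a₁ × a₂) (a₁ × a₂) ℂ) :
    (T₁.tensor T₂).map ((Φ₁.tensor Φ₂).map X) = (Ψ₁.tensor Ψ₂).map X := by
  have e₁ : Ψ₁.map = T₁.map ∘ₗ Φ₁.map := LinearMap.ext fun X => (h₁ X).symm
  have e₂ : Ψ₂.map = T₂.map ∘ₗ Φ₂.map := LinearMap.ext fun X => (h₂ X).symm
  rw [tensor_map_apply, tensor_map_apply, tensor_map_apply, ← tensorId_idTensor_comm, e₁, e₂]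
  rfl

end QuantumChannel

/-! ### Data processing and dimension bounds -/

section MutualInformation

variable {a b c d : Type*} [Fintype a] [DecidableEq a] [Fintype b] [DecidableEq b]
  [Fintype c] [DecidableEq c] [Fintype d] [DecidableEq d]

/-- Data processing for the quantum mutual information under local channels. -/
theorem mutualInformation_tensor_map_le (T₁ : QuantumChannel a c) (T₂ : QuantumChannel b d)
    {ρ : Matrix (a × b) (a × b) ℂ} (hρ : IsDensity ρ) :
    mutualInformation ((T₁.tensor T₂).map ρ) ≤ mutualInformation ρ := by
  have hρ' := (T₁.tensor T₂).map_isDensity hρ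
  obtain ⟨W, s, hW, hs⟩ := IsDiagonalization.exists_of_posSemidef hρ.1
  obtain ⟨U, p, hU, hp⟩ := IsDiagonalization.exists_of_posSemidef hρ.marginalFst.1
  obtain ⟨V, q, hV, hq⟩ := IsDiagonalization.exists_of_posSemidef hρ.marginalSnd.1
  obtain ⟨W', s', hW', hs'⟩ := IsDiagonalization.exists_of_posSemidef hρ'.1
  obtain ⟨U', p', hU', hp'⟩ := IsDiagonalization.exists_of_posSemidef hρ'.marginalFst.1
  obtain ⟨V', q', hV', hq'⟩ := IsDiagonalization.exists_of_posSemidef hρ'.marginalSnd.1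
  rw [← mul_le_mul_iff_left₀ (Real.log_pos one_lt_two),
    ← relativeEntropy_marginals hρ.1 hW hU hV, ← relativeEntropy_marginals hρ'.1 hW' hU' hV']
  refine relativeEntropy_le_of_forall_exists hW (hU.kronecker hV) hs
    (fun k => mul_nonneg (hp k.1) (hq k.2)) (conj_kronecker_eq_zero hρ.1 hU hV)
    hW' (hU'.kronecker hV') hs' (fun k => mul_nonneg (hp' k.1) (hq' k.2))
    (conj_kronecker_eq_zero hρ'.1 hU' hV') (by rw [hρ.2, hρ'.2]) fun X' => ?_
  -- The output marginals are images of the input marginals, so the product of the output marginals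
  -- is itself the image of ρ_A ⊗ ρ_B.
  rw [QuantumChannel.marginalFst_tensor_map, QuantumChannel.marginalSnd_tensor_map,
    ← QuantumChannel.tensor_map_kronecker]
  exact (T₁.tensor T₂).exists_trace_conj_le hρ.1
    (hρ.marginalFst.kronecker hρ.marginalSnd).1 X'

/-- Klein's inequality for ρ and the product of its marginals, both of trace one. -/
theorem mutualInformation_nonneg {ρ : Matrix (a × b) (a × b) ℂ} (hρ : IsDensity ρ) :
    0 ≤ mutualInformation ρ := by
  obtain ⟨W, s, hW, hs⟩ := IsDiagonalization.exists_of_posSemidef hρ.1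
  obtain ⟨U, p, hU, hp⟩ := IsDiagonalization.exists_of_posSemidef hρ.marginalFst.1
  obtain ⟨V, q, hV, hq⟩ := IsDiagonalization.exists_of_posSemidef hρ.marginalSnd.1
  have h := trace_sub_trace_le_relativeEntropy hW (hU.kronecker hV) hs
    (fun k => mul_nonneg (hp k.1) (hq k.2)) (conj_kronecker_eq_zero hρ.1 hU hV)
  rw [relativeEntropy_marginals hρ.1 hW hU hV, hρ.2,
    (hρ.marginalFst.kronecker hρ.marginalSnd).2, sub_self] at h
  exact nonneg_of_mul_nonneg_left h (Real.log_pos one_lt_two)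

/-- `ρ_{AB} ≤ d_B ρ_A ⊗ 1`. -/
theorem posSemidef_marginalFst_kronecker_one_sub {ρ : Matrix (a × b) (a × b) ℂ}
    (hρ : ρ.PosSemidef) :
    ((Fintype.card b : ℂ) • (marginalFst ρ ⊗ₖ (1 : Matrix b b ℂ)) - ρ).PosSemidef := by
  -- `D k l` is 1 ⊗ (|k⟩⟨k| - |l⟩⟨l|). Summing its conjugations yields -2ρ on the off-diagonal
  -- blocks and 2(d - 1)ρ on the diagonal ones; adding 2d times the remaining diagonal blocks of ρ_A
  -- ⊗ 1 and halving gives the claim.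
  let D : b → b → Matrix (a × b) (a × b) ℂ := fun k l =>
    diagonal fun x => (if x.2 = k then 1 else 0) - if x.2 = l then 1 else 0
  have h1 : (∑ k, ∑ l, D k l * ρ * (D k l)ᴴ).PosSemidef :=
    posSemidef_sum _ fun k _ => posSemidef_sum _ fun l _ => hρ.mul_mul_conjTranspose_same _
  have h2 : (∑ j : b, ∑ k ∈ Finset.univ.erase j,
      ρ.submatrix (fun i => (i, k)) (fun i => (i, k)) ⊗ₖ single j j (1 : ℂ)).PosSemidef := by
    refine posSemidef_sum _ fun j _ => posSemidef_sum _ fun k _ => (hρ.submatrix _).kronecker ?_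
    rw [← diagonal_single]
    refine posSemidef_diagonal_iff.mpr fun i => ?_
    by_cases h : i = j
    · subst h; simp
    · simp [h]
  have hd : (0 : ℂ) ≤ 2 * Fintype.card b := by exact_mod_cast Nat.zero_le (2 * Fintype.card b)
  have h3 := (h1.add (h2.smul hd)).smul (show (0 : ℂ) ≤ 1 / 2 by
    rw [Complex.le_def]; norm_num)
  convert h3 using 1
  ext ⟨i, x⟩ ⟨j, y⟩
  have e1 : (∑ k, ∑ l, D k l * ρ * (D k l)ᴴ) (i, x) (j, y) =
      (2 * (Fintype.card b : ℂ) * (if x = y then 1 else 0) - 2) * ρ (i, x) (j, y) := by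
    have e : ∀ k l, (D k l * ρ * (D k l)ᴴ) (i, x) (j, y) =
        ((if x = k then 1 else 0) - if x = l then 1 else 0) *
          ((if y = k then 1 else 0) - if y = l then 1 else 0) * ρ (i, x) (j, y) := by
      intro k l
      simp only [D, diagonal_conjTranspose, mul_diagonal, diagonal_mul, Pi.star_apply, star_sub,
        apply_ite (star : ℂ → ℂ), star_one, star_zero]
      ring
    simp only [Matrix.sum_apply, e, ← Finset.sum_mul]
    congr 1
    simp only [mul_sub, Finset.sum_sub_distrib, mul_ite, mul_one, mul_zero, Finset.sum_ite_eq,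
      Finset.mem_univ, if_true, Finset.sum_const,
      Finset.card_univ, nsmul_eq_mul]
    by_cases h : x = y
    · subst h; simp; ring
    · simp [h]; norm_num
  have e2 : (∑ j : b, ∑ k ∈ Finset.univ.erase j,
      ρ.submatrix (fun i => (i, k)) (fun i => (i, k)) ⊗ₖ single j j (1 : ℂ)) (i, x) (j, y) =
      if x = y then marginalFst ρ i j - ρ (i, x) (j, x) else 0 := by
    simp only [Matrix.sum_apply, kroneckerMap_apply, submatrix_apply, ← Finset.sum_mul]
    by_cases h : x = y
    · subst h
      rw [Finset.sum_eq_single x (fun k _ hk => by simp [hk]) (by simp),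
        Finset.sum_erase_eq_sub (Finset.mem_univ x)]
      simp [marginalFst]
    · rw [if_neg h]
      refine Finset.sum_eq_zero fun k _ => ?_
      rw [single_apply, if_neg (fun hk => h (hk.1.symm.trans hk.2)), mul_zero]
  simp only [Matrix.smul_apply, Matrix.add_apply, Matrix.sub_apply, e1, e2, kroneckerMap_apply,
    one_apply, smul_eq_mul]
  by_cases h : x = y
  · subst h; simp; ring
  · simp [h]

/-- `-H(B|A) ≤ log d_B`. -/
theorem vonNeumannEntropy_marginalFst_sub_le {ρ : Matrix (a × b) (a × b) ℂ} (hρ : IsDensity ρ) :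
    vonNeumannEntropy (marginalFst ρ) - vonNeumannEntropy ρ ≤
      Real.log (Fintype.card b) / Real.log 2 := by
  have hb : 0 < Fintype.card b := by
    refine Fintype.card_pos_iff.mpr ?_
    by_contra h
    rw [not_nonempty_iff] at h
    have := hρ.2
    simp [trace] at this
  have hb' : (0 : ℝ) < Fintype.card b := Nat.cast_pos.mpr hb
  set d : ℝ := (Fintype.card b : ℝ)
  obtain ⟨W, s, hW, hs⟩ := IsDiagonalization.exists_of_posSemidef hρ.1
  obtain ⟨U, p, hU, hp⟩ := IsDiagonalization.exists_of_posSemidef hρ.marginalFst.1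
  have h1 : IsDiagonalization (1 : Matrix b b ℂ) 1 (fun _ => 1) := by
    refine ⟨one_mem _, ?_⟩
    simp
  have hc : IsDiagonalization (((d⁻¹ : ℝ) : ℂ) • ρ) W (fun i => d⁻¹ * s i) := by
    refine ⟨hW.1, ?_⟩
    have : diagonal (fun i => ((d⁻¹ * s i : ℝ) : ℂ)) =
        ((d⁻¹ : ℝ) : ℂ) • diagonal (fun i => (s i : ℂ)) := by
      rw [← diagonal_smul]; congr 1; ext i; simp
    rw [this, mul_smul_comm, smul_mul_assoc, ← hW.2]
  have hs1 : ∑ i, s i = 1 := by rw [hW.sum_eigenvalues, hρ.2, Complex.one_re]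
  -- D(ρ‖σ) decreases when σ grows. Here d⁻¹ρ ≤ ρ_A ⊗ 1, so X = X' serves as witness; moreover
  -- D(ρ‖d⁻¹ρ) = log d and D(ρ‖ρ_A ⊗ 1) = H(A) - H(AB), in nats.
  have h := relativeEntropy_le_of_forall_exists hW hc hs
    (fun k => mul_nonneg (inv_nonneg.mpr hb'.le) (hs k))
    (fun j hj => by
      rw [hW.conj_apply, Complex.ofReal_re]
      exact (mul_eq_zero.mp hj).resolve_left (inv_pos.mpr hb').ne')
    hW (hU.kronecker h1) hs (fun k => mul_nonneg (hp k.1) zero_le_one)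
    (fun k hk => conj_kronecker_eq_zero_fst hρ.1 hU (by simp) k.1 (by simpa using hk) k.2)
    rfl (fun X' => ⟨X', le_rfl, by
      have h0 := ((posSemidef_marginalFst_kronecker_one_sub hρ.1).mul_mul_conjTranspose_same
        (1 - X')).trace_nonneg
      rw [mul_sub, sub_mul, trace_sub, mul_smul_comm, smul_mul_assoc, trace_smul] at h0
      have h0' := (Complex.le_def.mp h0).1
      rw [Complex.sub_re, smul_eq_mul, ← Complex.ofReal_natCast, Complex.re_ofReal_mul,
        Complex.zero_re, sub_nonneg] at h0'
      rw [mul_smul_comm, smul_mul_assoc, trace_smul, smul_eq_mul, Complex.re_ofReal_mul,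
        inv_mul_le_iff₀ hb']
      exact h0'⟩)
  rw [relativeEntropy_eq hW (hU.kronecker h1).mul_conjTranspose_self,
    relativeEntropy_eq hW hW.mul_conjTranspose_self] at h
  simp only [mul_one] at h
  rw [sum_conj_kronecker_mul_log_fst hU (by simp)] at h
  have e : ∑ j, ((Wᴴ * ρ * W) j j).re * Real.log (d⁻¹ * s j) =
      -Real.log d - ∑ j, Real.negMulLog (s j) := by
    calc _ = ∑ j, (s j * -Real.log d - Real.negMulLog (s j)) := by
          refine Finset.sum_congr rfl fun j _ => ?_
          rw [hW.conj_apply, Complex.ofReal_re, Real.negMulLog]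
          rcases (hs j).eq_or_lt with h | h
          · simp [← h]
          · rw [Real.log_mul (inv_pos.mpr hb').ne' h.ne', Real.log_inv]; ring
      _ = _ := by rw [Finset.sum_sub_distrib, ← Finset.sum_mul, hs1, one_mul]
  rw [e] at h
  rw [hU.vonNeumannEntropy_eq, hW.vonNeumannEntropy_eq, ← sub_div]
  refine div_le_div_of_nonneg_right ?_ (Real.log_pos one_lt_two).le
  linarith

/-- From -x log x ≤ 1 - x ≤ 1. A crude bound suffices, since only finiteness is needed. -/
theorem vonNeumannEntropy_le_card {ρ : Matrix a a ℂ} (hρ : ρ.PosSemidef) :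
    vonNeumannEntropy ρ ≤ Fintype.card a / Real.log 2 := by
  obtain ⟨W, s, hW, hs⟩ := IsDiagonalization.exists_of_posSemidef hρ
  rw [hW.vonNeumannEntropy_eq]
  refine div_le_div_of_nonneg_right ?_ (Real.log_pos one_lt_two).le
  calc ∑ i, Real.negMulLog (s i) ≤ ∑ _i : a, (1 : ℝ) := Finset.sum_le_sum fun i _ => by
        rcases (hs i).eq_or_lt with h | h
        · simp [← h]
        · have h2 := mul_le_mul_of_nonneg_left (Real.one_sub_inv_le_log_of_pos h) h.le
          rw [mul_sub, mul_inv_cancel₀ h.ne'] at h2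
          rw [Real.negMulLog]
          linarith
    _ = Fintype.card a := by simp

end MutualInformation

/-! ### The information difference of a pair of channels -/

namespace QuantumChannel

/-- `I(R;B) - I(R;C)` for two channels from `A` to `B` and to `C`. -/
noncomputable def infoDiff {a b c r : Type*} [Fintype a] [Fintype b] [DecidableEq b] [Fintype c]
    [DecidableEq c] [Fintype r] [DecidableEq r] (Φ : QuantumChannel a b) (Ψ : QuantumChannel a c)
    (ρ : Matrix (r × a) (r × a) ℂ) : ℝ :=
  mutualInformation (idTensor r Φ.map ρ) - mutualInformation (idTensor r Ψ.map ρ)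

section

variable {a b c r : Type*} [Fintype a] [Fintype b] [DecidableEq b] [Fintype c] [DecidableEq c]
  [Fintype r] [DecidableEq r] (Φ : QuantumChannel a b) (Ψ : QuantumChannel a c)

theorem mutualInformation_idTensor (ρ : Matrix (r × a) (r × a) ℂ) :
    mutualInformation (idTensor r Φ.map ρ) = vonNeumannEntropy (marginalFst ρ) +
      vonNeumannEntropy (Φ.map (marginalSnd ρ)) - vonNeumannEntropy (idTensor r Φ.map ρ) := by
  rw [mutualInformation, marginalFst_idTensor Φ.trace_preserving, marginalSnd_idTensor]

/-- The entropy of the reference is the same for both channels and cancels. -/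
theorem infoDiff_eq (ρ : Matrix (r × a) (r × a) ℂ) :
    infoDiff Φ Ψ ρ =
      (vonNeumannEntropy (Φ.map (marginalSnd ρ)) - vonNeumannEntropy (idTensor r Φ.map ρ)) -
      (vonNeumannEntropy (Ψ.map (marginalSnd ρ)) - vonNeumannEntropy (idTensor r Ψ.map ρ)) := by
  rw [infoDiff, mutualInformation_idTensor, mutualInformation_idTensor]
  ring

theorem infoDiff_le {ρ : Matrix (r × a) (r × a) ℂ} (hρ : IsDensity ρ) :
    infoDiff Φ Ψ ρ ≤
      Fintype.card b / Real.log 2 + Real.log (Fintype.card b) / Real.log 2 := by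
  have h1 := mutualInformation_nonneg (Ψ.idTensor_isDensity hρ)
  have hd := Φ.idTensor_isDensity hρ
  have h2 := vonNeumannEntropy_marginalFst_sub_le hd
  have h3 := vonNeumannEntropy_le_card hd.marginalSnd.1
  rw [infoDiff, mutualInformation]
  linarith

theorem infoDiff_submatrix {s : Type*} [Fintype s] [DecidableEq s] (e : s ≃ r)
    {ρ : Matrix (r × a) (r × a) ℂ} (hρ : IsDensity ρ) :
    infoDiff Φ Ψ (ρ.submatrix (e.prodCongr (Equiv.refl a)) (e.prodCongr (Equiv.refl a))) =
      infoDiff Φ Ψ ρ := by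
  have hm : marginalSnd (ρ.submatrix (e.prodCongr (Equiv.refl a)) (e.prodCongr (Equiv.refl a))) =
      marginalSnd ρ := by
    ext i j
    exact Equiv.sum_comp e fun k => ρ (k, i) (k, j)
  have hi : ∀ {d : Type _} [Fintype d] [DecidableEq d] (Θ : QuantumChannel a d),
      vonNeumannEntropy (idTensor s Θ.map
        (ρ.submatrix (e.prodCongr (Equiv.refl a)) (e.prodCongr (Equiv.refl a)))) =
      vonNeumannEntropy (idTensor r Θ.map ρ) := fun {d} _ _ Θ =>
    vonNeumannEntropy_submatrix (Θ.idTensor_isDensity hρ).1.1 (e.prodCongr (Equiv.refl d))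
  rw [infoDiff_eq, infoDiff_eq, hm, hi]
  congr 2
  exact vonNeumannEntropy_submatrix (Ψ.idTensor_isDensity hρ).1.1 (e.prodCongr (Equiv.refl c))

theorem infoDiff_relabel {b' c' : Type*} [Fintype b'] [DecidableEq b'] [Fintype c']
    [DecidableEq c'] (e : b' ≃ b) (f : c' ≃ c) {ρ : Matrix (r × a) (r × a) ℂ}
    (hρ : IsDensity ρ) : infoDiff (Φ.relabel e) (Ψ.relabel f) ρ = infoDiff Φ Ψ ρ := by
  rw [infoDiff_eq, infoDiff_eq]
  have h1 := vonNeumannEntropy_submatrix (Φ.map_isDensity hρ.marginalSnd).1.1 e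
  have h2 := vonNeumannEntropy_submatrix (Ψ.map_isDensity hρ.marginalSnd).1.1 f
  have h3 := vonNeumannEntropy_submatrix (Φ.idTensor_isDensity hρ).1.1
    ((Equiv.refl r).prodCongr e)
  have h4 := vonNeumannEntropy_submatrix (Ψ.idTensor_isDensity hρ).1.1
    ((Equiv.refl r).prodCongr f)
  rw [← h1, ← h2, ← h3, ← h4]
  rfl

end

/-! ### Absorbing one output into the reference -/

section Tensor

variable {a₁ a₂ b₁ b₂ r : Type*} [Fintype a₁] [Fintype a₂] [Fintype b₁] [Fintype b₂] [Fintype r]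

/-- The state on `(R B₂) A₁` obtained from a state on `R (A₁ A₂)` by a channel on `A₂`. -/
def applySnd (Φ : QuantumChannel a₂ b₂) (ρ : Matrix (r × a₁ × a₂) (r × a₁ × a₂) ℂ) :
    Matrix ((r × b₂) × a₁) ((r × b₂) × a₁) ℂ :=
  (idTensor (r × a₁) Φ.map
    (ρ.submatrix (Equiv.prodAssoc r a₁ a₂) (Equiv.prodAssoc r a₁ a₂))).submatrix
    (fun x => ((x.1.1, x.2), x.1.2)) (fun x => ((x.1.1, x.2), x.1.2))

/-- The state on `(R B₁) A₂` obtained from a state on `R (A₁ A₂)` by a channel on `A₁`. -/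
def applyFst (Φ : QuantumChannel a₁ b₁) (ρ : Matrix (r × a₁ × a₂) (r × a₁ × a₂) ℂ) :
    Matrix ((r × b₁) × a₂) ((r × b₁) × a₂) ℂ :=
  applySnd Φ (ρ.submatrix ((Equiv.refl r).prodCongr (Equiv.prodComm a₂ a₁))
    ((Equiv.refl r).prodCongr (Equiv.prodComm a₂ a₁)))

/-- Exchanging the last two factors. -/
def prodRightComm (r a b : Type*) : (r × b) × a ≃ (r × a) × b where
  toFun x := ((x.1.1, x.2), x.1.2)
  invFun x := ((x.1.1, x.2), x.1.2)
  left_inv _ := rfl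
  right_inv _ := rfl

theorem applySnd_isDensity (Φ : QuantumChannel a₂ b₂)
    {ρ : Matrix (r × a₁ × a₂) (r × a₁ × a₂) ℂ} (hρ : IsDensity ρ) :
    IsDensity (applySnd Φ ρ) :=
  (Φ.idTensor_isDensity (hρ.submatrix (Equiv.prodAssoc r a₁ a₂))).submatrix (prodRightComm r a₁ b₂)

theorem applyFst_isDensity (Φ : QuantumChannel a₁ b₁)
    {ρ : Matrix (r × a₁ × a₂) (r × a₁ × a₂) ℂ} (hρ : IsDensity ρ) :
    IsDensity (applyFst Φ ρ) :=
  applySnd_isDensity Φ (hρ.submatrix ((Equiv.refl r).prodCongr (Equiv.prodComm a₂ a₁)))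

/-- Tracing out the output of a trace-preserving map is the same as tracing out its input. -/
theorem marginalSnd_applySnd {a₁ : Type*} (Φ : QuantumChannel a₂ b₂)
    (ρ : Matrix (r × a₁ × a₂) (r × a₁ × a₂) ℂ) :
    marginalSnd (applySnd Φ ρ) = marginalFst (marginalSnd ρ) := by
  ext u v
  have h := fun i : r => Φ.trace_preserving (of fun w z => ρ (i, (u, w)) (i, (v, z)))
  calc marginalSnd (applySnd Φ ρ) u v
      = ∑ i : r, (Φ.map (of fun w z => ρ (i, (u, w)) (i, (v, z)))).trace :=
        Fintype.sum_prod_type _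
    _ = ∑ i : r, ∑ w, ρ (i, (u, w)) (i, (v, w)) := Finset.sum_congr rfl fun i _ => h i
    _ = _ := Finset.sum_comm

theorem marginalSnd_applyFst {a₂ : Type*} (Φ : QuantumChannel a₁ b₁)
    (ρ : Matrix (r × a₁ × a₂) (r × a₁ × a₂) ℂ) :
    marginalSnd (applyFst Φ ρ) = marginalSnd (marginalSnd ρ) := by
  rw [applyFst, marginalSnd_applySnd]
  rfl

end Tensor

section Tensor

variable {a₁ a₂ b₁ b₂ c₁ c₂ r : Type*} [Fintype a₁] [Fintype a₂]
  [Fintype b₁] [DecidableEq b₁] [Fintype b₂] [DecidableEq b₂]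
  [Fintype c₁] [DecidableEq c₁] [Fintype c₂] [DecidableEq c₂] [Fintype r] [DecidableEq r]

theorem entropy_idTensor_applySnd (Φ : QuantumChannel a₁ b₁) (Ψ : QuantumChannel a₂ b₂)
    {ρ : Matrix (r × a₁ × a₂) (r × a₁ × a₂) ℂ} (hρ : IsDensity ρ) :
    vonNeumannEntropy (idTensor (r × b₂) Φ.map (applySnd Ψ ρ)) =
      vonNeumannEntropy (idTensor r (Φ.tensor Ψ).map ρ) := by
  rw [← vonNeumannEntropy_submatrix ((Φ.tensor Ψ).idTensor_isDensity hρ).1.1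
    ((prodRightComm r b₁ b₂).trans (Equiv.prodAssoc r b₁ b₂))]
  rfl

/-- Here the first channel acts before the second, opposite to the order in the definition of
`tensor`, so commutation of local maps is needed. -/
theorem entropy_idTensor_applyFst (Φ : QuantumChannel a₁ b₁) (Ψ : QuantumChannel a₂ b₂)
    {ρ : Matrix (r × a₁ × a₂) (r × a₁ × a₂) ℂ} (hρ : IsDensity ρ) :
    vonNeumannEntropy (idTensor (r × b₁) Ψ.map (applyFst Φ ρ)) =
      vonNeumannEntropy (idTensor r (Φ.tensor Ψ).map ρ) := by
  rw [← vonNeumannEntropy_submatrix ((Φ.tensor Ψ).idTensor_isDensity hρ).1.1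
    (Equiv.prodAssoc r b₁ b₂)]
  congr 1
  ext p q
  have h := tensorId_idTensor_comm Φ.map Ψ.map (of fun x y => ρ (p.1.1, x) (q.1.1, y))
  exact (congrFun (congrFun h (p.1.2, p.2)) (q.1.2, q.2)).symm

/-- If `Ψᵢ = Tᵢ ∘ Φᵢ`, the information difference of `(Φ₁ ⊗ Φ₂, Ψ₁ ⊗ Ψ₂)` is at most the sum of
information differences of `(Φ₁, Ψ₁)` and `(Φ₂, Ψ₂)`, with reference systems `R B₂` and `R C₁`. -/
theorem infoDiff_tensor_le {Φ₁ : QuantumChannel a₁ b₁} {Φ₂ : QuantumChannel a₂ b₂}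
    {T₁ : QuantumChannel b₁ c₁} {T₂ : QuantumChannel b₂ c₂}
    {Ψ₁ : QuantumChannel a₁ c₁} {Ψ₂ : QuantumChannel a₂ c₂}
    (h₁ : ∀ X, T₁.map (Φ₁.map X) = Ψ₁.map X) (h₂ : ∀ X, T₂.map (Φ₂.map X) = Ψ₂.map X)
    {ρ : Matrix (r × a₁ × a₂) (r × a₁ × a₂) ℂ} (hρ : IsDensity ρ) :
    infoDiff (Φ₁.tensor Φ₂) (Ψ₁.tensor Ψ₂) ρ ≤
      infoDiff Φ₁ Ψ₁ (applySnd Φ₂ ρ) + infoDiff Φ₂ Ψ₂ (applyFst Ψ₁ ρ) := by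
  -- This is I(C₁;C₂) ≤ I(B₁;B₂), exactly what remains after the joint entropies with R cancel.
  have hm := mutualInformation_tensor_map_le T₁ T₂
    ((Φ₁.tensor Φ₂).map_isDensity hρ.marginalSnd)
  rw [tensor_map_tensor_map h₁ h₂] at hm
  simp only [mutualInformation, marginalFst_tensor_map, marginalSnd_tensor_map] at hm
  simp only [infoDiff_eq, marginalSnd_applyFst, marginalSnd_applySnd]
  rw [entropy_idTensor_applySnd Φ₁ Φ₂ hρ, entropy_idTensor_applySnd Ψ₁ Φ₂ hρ,
    entropy_idTensor_applyFst Ψ₁ Φ₂ hρ, entropy_idTensor_applyFst Ψ₁ Ψ₂ hρ]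
  linarith

variable {s : Type*} [Fintype s] [DecidableEq s]

theorem entropy_idTensor_tensor (Φ : QuantumChannel a₁ b₁) (Ψ : QuantumChannel a₂ b₂)
    {ρ : Matrix (r × a₁) (r × a₁) ℂ} {σ : Matrix (s × a₂) (s × a₂) ℂ}
    (hρ : IsDensity ρ) (hσ : IsDensity σ) :
    vonNeumannEntropy (idTensor (r × s) (Φ.tensor Ψ).map
      ((ρ ⊗ₖ σ).submatrix (Equiv.prodProdProdComm r s a₁ a₂)
        (Equiv.prodProdProdComm r s a₁ a₂))) =
      vonNeumannEntropy (idTensor r Φ.map ρ) + vonNeumannEntropy (idTensor s Ψ.map σ) := by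
  rw [← vonNeumannEntropy_kronecker (Φ.idTensor_isDensity hρ) (Ψ.idTensor_isDensity hσ),
    ← vonNeumannEntropy_submatrix ((Φ.idTensor_isDensity hρ).kronecker
      (Ψ.idTensor_isDensity hσ)).1.1 (Equiv.prodProdProdComm r s b₁ b₂)]
  congr 1
  ext p q
  have h := tensor_map_kronecker Φ Ψ (of fun x y => ρ (p.1.1, x) (q.1.1, y))
    (of fun x y => σ (p.1.2, x) (q.1.2, y))
  exact congrFun (congrFun h p.2) q.2

theorem infoDiff_tensor_kronecker (Φ₁ : QuantumChannel a₁ b₁) (Φ₂ : QuantumChannel a₂ b₂)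
    (Ψ₁ : QuantumChannel a₁ c₁) (Ψ₂ : QuantumChannel a₂ c₂)
    {ρ : Matrix (r × a₁) (r × a₁) ℂ} {σ : Matrix (s × a₂) (s × a₂) ℂ}
    (hρ : IsDensity ρ) (hσ : IsDensity σ) :
    infoDiff (Φ₁.tensor Φ₂) (Ψ₁.tensor Ψ₂)
      ((ρ ⊗ₖ σ).submatrix (Equiv.prodProdProdComm r s a₁ a₂)
        (Equiv.prodProdProdComm r s a₁ a₂)) = infoDiff Φ₁ Ψ₁ ρ + infoDiff Φ₂ Ψ₂ σ := by
  have hm : marginalSnd ((ρ ⊗ₖ σ).submatrix (Equiv.prodProdProdComm r s a₁ a₂)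
      (Equiv.prodProdProdComm r s a₁ a₂)) = marginalSnd ρ ⊗ₖ marginalSnd σ := by
    ext x y
    simp only [marginalSnd, of_apply, kroneckerMap_apply, Finset.sum_mul_sum,
      Fintype.sum_prod_type]
    rfl
  simp only [infoDiff_eq, hm, tensor_map_kronecker]
  rw [entropy_idTensor_tensor Φ₁ Φ₂ hρ hσ, entropy_idTensor_tensor Ψ₁ Ψ₂ hρ hσ,
    vonNeumannEntropy_kronecker (Φ₁.map_isDensity hρ.marginalSnd)
      (Φ₂.map_isDensity hσ.marginalSnd),
    vonNeumannEntropy_kronecker (Ψ₁.map_isDensity hρ.marginalSnd)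
      (Ψ₂.map_isDensity hσ.marginalSnd)]
  ring

end Tensor

end QuantumChannel

/-! ### Broadcast channels -/

section PartialTrace

variable {ι ι₁ ι₂ : Type*}

/-- The partial trace is a sum of principal submatrices, one for each basis state of the discarded
systems. -/
theorem idTensor_partialTraceTo_posSemidef [Fintype ι] [DecidableEq ι] (d : ι → ℕ) (S : Finset ι)
    {r : Type*} [Fintype r] {X : Matrix (r × ((i : ι) → Fin (d i))) (r × ((i : ι) → Fin (d i))) ℂ}
    (hX : X.PosSemidef) : (idTensor r (partialTraceTo d S) X).PosSemidef := by
  have : idTensor r (partialTraceTo d S) X =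
      ∑ z : (i : {i : ι // ¬ i ∈ S}) → Fin (d i), X.submatrix
        (fun p => (p.1, (Equiv.piEquivPiSubtypeProd (fun i => i ∈ S) fun i => Fin (d i)).symm
          (p.2, z)))
        (fun p => (p.1, (Equiv.piEquivPiSubtypeProd (fun i => i ∈ S) fun i => Fin (d i)).symm
          (p.2, z))) := by
    ext p q
    rw [Matrix.sum_apply]
    rfl
  rw [this]
  exact posSemidef_sum _ fun z _ => hX.submatrix _

theorem trace_partialTraceTo [Fintype ι] [DecidableEq ι] (d : ι → ℕ) (S : Finset ι)
    (X : Matrix ((i : ι) → Fin (d i)) ((i : ι) → Fin (d i)) ℂ) :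
    (partialTraceTo d S X).trace = X.trace := by
  have h := Equiv.sum_comp
    (Equiv.piEquivPiSubtypeProd (fun i => i ∈ S) fun i => Fin (d i)).symm fun x => X x x
  rw [Fintype.sum_prod_type] at h
  exact h

theorem piEquivPiSubtypeProd_symm_apply_of_mem [DecidableEq ι] (d : ι → ℕ) (S : Finset ι)
    (x : SystemOf d S) (z : (i : {i : ι // ¬ i ∈ S}) → Fin (d i)) {i : ι} (h : i ∈ S) :
    (Equiv.piEquivPiSubtypeProd (fun i => i ∈ S) fun i => Fin (d i)).symm (x, z) i = x ⟨i, h⟩ :=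
  dif_pos h

theorem piEquivPiSubtypeProd_symm_apply_of_notMem [DecidableEq ι] (d : ι → ℕ) (S : Finset ι)
    (x : SystemOf d S) (z : (i : {i : ι // ¬ i ∈ S}) → Fin (d i)) {i : ι} (h : ¬ i ∈ S) :
    (Equiv.piEquivPiSubtypeProd (fun i => i ∈ S) fun i => Fin (d i)).symm (x, z) i = z ⟨i, h⟩ :=
  dif_neg h

/-- A family over a subset of `ι₁ ⊕ ι₂` is a pair of families. -/
def subtypeSumPiEquiv (d₁ : ι₁ → ℕ) (d₂ : ι₂ → ℕ) {p : ι₁ ⊕ ι₂ → Prop} {p₁ : ι₁ → Prop}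
    {p₂ : ι₂ → Prop} (h₁ : ∀ i, p (Sum.inl i) ↔ p₁ i) (h₂ : ∀ i, p (Sum.inr i) ↔ p₂ i) :
    ((i : {i // p i}) → Fin (Sum.elim d₁ d₂ i)) ≃
      ((i : {i // p₁ i}) → Fin (d₁ i)) × ((i : {i // p₂ i}) → Fin (d₂ i)) where
  toFun x := (fun i => x ⟨Sum.inl i, (h₁ i).mpr i.2⟩, fun i => x ⟨Sum.inr i, (h₂ i).mpr i.2⟩)
  invFun y := fun
    | ⟨Sum.inl i, hi⟩ => y.1 ⟨i, (h₁ i).mp hi⟩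
    | ⟨Sum.inr i, hi⟩ => y.2 ⟨i, (h₂ i).mp hi⟩
  left_inv x := by
    funext i
    rcases i with ⟨i | i, hi⟩ <;> rfl
  right_inv y := rfl

/-- The joint system of `S₁ ⊔ S₂` is the product of the joint systems of `S₁` and `S₂`. -/
def systemOfDisjSumEquiv (d₁ : ι₁ → ℕ) (d₂ : ι₂ → ℕ) (S₁ : Finset ι₁) (S₂ : Finset ι₂) :
    SystemOf (Sum.elim d₁ d₂) (S₁.disjSum S₂) ≃ SystemOf d₁ S₁ × SystemOf d₂ S₂ :=
  subtypeSumPiEquiv d₁ d₂ (fun _ => Finset.inl_mem_disjSum) (fun _ => Finset.inr_mem_disjSum)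

variable [Fintype ι₁] [DecidableEq ι₁] [Fintype ι₂] [DecidableEq ι₂]

theorem partialTraceTo_disjSum (d₁ : ι₁ → ℕ) (d₂ : ι₂ → ℕ) (S₁ : Finset ι₁) (S₂ : Finset ι₂)
    (Y : Matrix (((i : ι₁) → Fin (d₁ i)) × ((i : ι₂) → Fin (d₂ i)))
      (((i : ι₁) → Fin (d₁ i)) × ((i : ι₂) → Fin (d₂ i))) ℂ) :
    partialTraceTo (Sum.elim d₁ d₂) (S₁.disjSum S₂)
        (Y.submatrix (Equiv.sumPiEquivProdPi fun i => Fin (Sum.elim d₁ d₂ i))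
          (Equiv.sumPiEquivProdPi fun i => Fin (Sum.elim d₁ d₂ i))) =
      (tensorId (partialTraceTo d₁ S₁) (SystemOf d₂ S₂)
        (idTensor ((i : ι₁) → Fin (d₁ i)) (partialTraceTo d₂ S₂) Y)).submatrix
          (systemOfDisjSumEquiv d₁ d₂ S₁ S₂) (systemOfDisjSumEquiv d₁ d₂ S₁ S₂) := by
  -- Splits the traced-out coordinates into those of each channel, so that one sum becomes a double
  -- sum.
  let E := subtypeSumPiEquiv d₁ d₂ (p := fun i => ¬ i ∈ S₁.disjSum S₂) (p₁ := fun i => ¬ i ∈ S₁)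
    (p₂ := fun i => ¬ i ∈ S₂) (fun _ => not_congr Finset.inl_mem_disjSum)
    (fun _ => not_congr Finset.inr_mem_disjSum)
  have key : ∀ (x : SystemOf (Sum.elim d₁ d₂) (S₁.disjSum S₂))
      (z : (i : {i // ¬ i ∈ S₁.disjSum S₂}) → Fin (Sum.elim d₁ d₂ i)),
      Equiv.sumPiEquivProdPi (fun i => Fin (Sum.elim d₁ d₂ i))
        ((Equiv.piEquivPiSubtypeProd (fun i => i ∈ S₁.disjSum S₂)
          fun i => Fin (Sum.elim d₁ d₂ i)).symm (x, z)) =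
      ((Equiv.piEquivPiSubtypeProd (fun i => i ∈ S₁) fun i => Fin (d₁ i)).symm
          ((systemOfDisjSumEquiv d₁ d₂ S₁ S₂ x).1, (E z).1),
        (Equiv.piEquivPiSubtypeProd (fun i => i ∈ S₂) fun i => Fin (d₂ i)).symm
          ((systemOfDisjSumEquiv d₁ d₂ S₁ S₂ x).2, (E z).2)) := by
    intro x z
    refine Prod.ext (funext fun i => ?_) (funext fun i => ?_)
    · by_cases h : i ∈ S₁
      · exact (piEquivPiSubtypeProd_symm_apply_of_mem _ _ _ _ (Finset.inl_mem_disjSum.mpr h)).trans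
          (piEquivPiSubtypeProd_symm_apply_of_mem d₁ S₁
            (systemOfDisjSumEquiv d₁ d₂ S₁ S₂ x).1 (E z).1 h).symm
      · exact (piEquivPiSubtypeProd_symm_apply_of_notMem _ _ _ _
          (fun h' => h (Finset.inl_mem_disjSum.mp h'))).trans
          (piEquivPiSubtypeProd_symm_apply_of_notMem d₁ S₁
            (systemOfDisjSumEquiv d₁ d₂ S₁ S₂ x).1 (E z).1 h).symm
    · by_cases h : i ∈ S₂
      · exact (piEquivPiSubtypeProd_symm_apply_of_mem _ _ _ _ (Finset.inr_mem_disjSum.mpr h)).trans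
          (piEquivPiSubtypeProd_symm_apply_of_mem d₂ S₂
            (systemOfDisjSumEquiv d₁ d₂ S₁ S₂ x).2 (E z).2 h).symm
      · exact (piEquivPiSubtypeProd_symm_apply_of_notMem _ _ _ _
          (fun h' => h (Finset.inr_mem_disjSum.mp h'))).trans
          (piEquivPiSubtypeProd_symm_apply_of_notMem d₂ S₂
            (systemOfDisjSumEquiv d₁ d₂ S₁ S₂ x).2 (E z).2 h).symm
  ext x y
  change ∑ z, Y (Equiv.sumPiEquivProdPi (fun i => Fin (Sum.elim d₁ d₂ i)) _)
    (Equiv.sumPiEquivProdPi (fun i => Fin (Sum.elim d₁ d₂ i)) _) = ∑ z₁, ∑ z₂, Y (_, _) (_, _)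
  simp only [key]
  rw [← Fintype.sum_prod_type']
  exact Equiv.sum_comp E fun z => Y
    ((Equiv.piEquivPiSubtypeProd (fun i => i ∈ S₁) fun i => Fin (d₁ i)).symm
        ((systemOfDisjSumEquiv d₁ d₂ S₁ S₂ x).1, z.1),
      (Equiv.piEquivPiSubtypeProd (fun i => i ∈ S₂) fun i => Fin (d₂ i)).symm
        ((systemOfDisjSumEquiv d₁ d₂ S₁ S₂ x).2, z.2))
    ((Equiv.piEquivPiSubtypeProd (fun i => i ∈ S₁) fun i => Fin (d₁ i)).symm
        ((systemOfDisjSumEquiv d₁ d₂ S₁ S₂ y).1, z.1),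
      (Equiv.piEquivPiSubtypeProd (fun i => i ∈ S₂) fun i => Fin (d₂ i)).symm
        ((systemOfDisjSumEquiv d₁ d₂ S₁ S₂ y).2, z.2))

end PartialTrace

open scoped MatrixOrder Matrix.Norms.L2Operator in
/-- Linear maps that agree on states are equal. -/
theorem linearMap_ext_of_isDensity {a b : Type*} [Fintype a]
    {Φ Ψ : Matrix a a ℂ →ₗ[ℂ] Matrix b b ℂ} (h : ∀ ρ, IsDensity ρ → Φ ρ = Ψ ρ) : Φ = Ψ := by
  classical
  refine LinearMap.ext_on (CStarAlgebra.span_nonneg (A := Matrix a a ℂ)) fun X hX => ?_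
  have hX' : X.PosSemidef := nonneg_iff_posSemidef.mp hX
  -- Positive matrices span; each is either zero or a scalar multiple of a state.
  by_cases h0 : X.trace = 0
  · rw [hX'.trace_eq_zero_iff.mp h0, map_zero, map_zero]
  · have hd : IsDensity (X.trace⁻¹ • X) :=
      ⟨hX'.smul (inv_nonneg_of_nonneg hX'.trace_nonneg), by
        rw [trace_smul, smul_eq_mul, inv_mul_cancel₀ h0]⟩
    have := h _ hd
    rw [map_smul, map_smul] at this
    exact smul_right_injective _ (inv_ne_zero h0) this

theorem idTensor_comp (r : Type*) {a b c : Type*} (Φ : Matrix b b ℂ →ₗ[ℂ] Matrix c c ℂ)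
    (Ψ : Matrix a a ℂ →ₗ[ℂ] Matrix b b ℂ) (X : Matrix (r × a) (r × a) ℂ) :
    idTensor r (Φ.comp Ψ) X = idTensor r Φ (idTensor r Ψ X) := rfl

theorem exists_isDensity (a : Type*) [Fintype a] [Nonempty a] :
    ∃ ρ : Matrix a a ℂ, IsDensity ρ := by
  classical
  refine ⟨(Fintype.card a : ℂ)⁻¹ • (1 : Matrix a a ℂ), PosSemidef.one.smul ?_, ?_⟩
  · exact inv_nonneg_of_nonneg (by exact_mod_cast Nat.zero_le _)
  · rw [trace_smul, trace_one, smul_eq_mul, inv_mul_cancel₀]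
    exact_mod_cast Fintype.card_ne_zero

namespace BroadcastChannel

variable {a ι : Type*} [Fintype a] [Fintype ι] [DecidableEq ι]

/-- The channel to the receivers in `S`. -/
def receive (N : BroadcastChannel a ι) (S : Finset ι) : QuantumChannel a (SystemOf N.dim S) where
  map := (partialTraceTo N.dim S).comp N.channel.map
  completely_positive k X hX := by
    rw [idTensor_comp]
    exact idTensor_partialTraceTo_posSemidef N.dim S (N.channel.completely_positive k X hX)
  trace_preserving X := (trace_partialTraceTo _ _ _).trans (N.channel.trace_preserving X)

theorem informationDifference_eq (N : BroadcastChannel a ι) {r : Type*} [Fintype r]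
    [DecidableEq r] (ρ : Matrix (r × a) (r × a) ℂ) :
    N.informationDifference ρ = (N.receive N.decoding).infoDiff (N.receive N.malicious) ρ := by
  rw [QuantumChannel.infoDiff, receive, receive, idTensor_comp, idTensor_comp]
  rfl

/-- States span all matrices, so the degrading relation extends from states to all operators. This
makes it an identity of linear maps, which can be tensored. -/
theorem IsDegraded.exists_map_receive {N : BroadcastChannel a ι} (hN : N.IsDegraded) :
    ∃ T : QuantumChannel (SystemOf N.dim N.decoding) (SystemOf N.dim N.malicious),
      ∀ X, T.map ((N.receive N.decoding).map X) = (N.receive N.malicious).map X := by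
  obtain ⟨T, hT⟩ := hN
  exact ⟨T, LinearMap.congr_fun (linearMap_ext_of_isDensity
    (Φ := T.map.comp (N.receive N.decoding).map) (Ψ := (N.receive N.malicious).map) hT)⟩

/-- The supremum ranges over references `Fin k`; relabelling a basis admits composite references
such as R B₂. -/
theorem informationDifference_mem (N : BroadcastChannel a ι) {r : Type*} [Fintype r]
    [DecidableEq r] {ρ : Matrix (r × a) (r × a) ℂ} (hρ : IsDensity ρ) :
    N.informationDifference ρ ∈ N.privateInformationValues := by
  let e : Fin (Fintype.card r) ≃ r := (Fintype.equivFin r).symm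
  refine ⟨_, _, hρ.submatrix (e.prodCongr (Equiv.refl a)), ?_⟩
  rw [informationDifference_eq, informationDifference_eq,
    QuantumChannel.infoDiff_submatrix _ _ e hρ]

theorem bddAbove_privateInformationValues (N : BroadcastChannel a ι) :
    BddAbove N.privateInformationValues := by
  let d : ℝ := Fintype.card (SystemOf N.dim N.decoding)
  refine ⟨d / Real.log 2 + Real.log d / Real.log 2, ?_⟩
  rintro _ ⟨k, ρ, hρ, rfl⟩
  rw [informationDifference_eq]
  exact QuantumChannel.infoDiff_le _ _ hρ

theorem privateInformationValues_nonempty [Nonempty a] (N : BroadcastChannel a ι) :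
    N.privateInformationValues.Nonempty := by
  obtain ⟨ρ, hρ⟩ := exists_isDensity (Fin 1 × a)
  exact ⟨_, 1, ρ, hρ, rfl⟩

theorem informationDifference_le (N : BroadcastChannel a ι) {r : Type*} [Fintype r]
    [DecidableEq r] {ρ : Matrix (r × a) (r × a) ℂ} (hρ : IsDensity ρ) :
    N.informationDifference ρ ≤ N.privateInformationEA :=
  le_csSup N.bddAbove_privateInformationValues (N.informationDifference_mem hρ)

variable {a₁ a₂ ι₁ ι₂ : Type*} [Fintype a₁] [Fintype a₂] [Fintype ι₁] [DecidableEq ι₁]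
  [Fintype ι₂] [DecidableEq ι₂] (N : BroadcastChannel a₁ ι₁) (M : BroadcastChannel a₂ ι₂)

/-- The partial trace factorises over the two groups of receivers and commutes past the channel on
the other factor. -/
theorem tensor_receive_map (S₁ : Finset ι₁) (S₂ : Finset ι₂) :
    ((N.tensor M).receive (S₁.disjSum S₂)).map =
      (((N.receive S₁).tensor (M.receive S₂)).relabel
        (systemOfDisjSumEquiv N.dim M.dim S₁ S₂)).map := by
  refine LinearMap.ext fun X => ?_
  have h := partialTraceTo_disjSum N.dim M.dim S₁ S₂
    (tensorId N.channel.map _ (idTensor a₁ M.channel.map X))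
  rw [← tensorId_idTensor_comm] at h
  exact h

theorem informationDifference_tensor {r : Type*} [Fintype r] [DecidableEq r]
    {ρ : Matrix (r × a₁ × a₂) (r × a₁ × a₂) ℂ} (hρ : IsDensity ρ) :
    (N.tensor M).informationDifference ρ =
      ((N.receive N.decoding).tensor (M.receive M.decoding)).infoDiff
        ((N.receive N.malicious).tensor (M.receive M.malicious)) ρ := by
  rw [← QuantumChannel.infoDiff_relabel _ _ (systemOfDisjSumEquiv N.dim M.dim _ _)
    (systemOfDisjSumEquiv N.dim M.dim _ _) hρ, QuantumChannel.infoDiff, ← tensor_receive_map,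
    ← tensor_receive_map]
  rfl

theorem privateInformationEA_tensor_le [Nonempty a₁] [Nonempty a₂] (hN : N.IsDegraded)
    (hM : M.IsDegraded) :
    (N.tensor M).privateInformationEA ≤ N.privateInformationEA + M.privateInformationEA := by
  obtain ⟨T₁, h₁⟩ := hN.exists_map_receive
  obtain ⟨T₂, h₂⟩ := hM.exists_map_receive
  refine csSup_le (N.tensor M).privateInformationValues_nonempty ?_
  rintro _ ⟨k, ρ, hρ, rfl⟩
  rw [informationDifference_tensor N M hρ]
  refine (QuantumChannel.infoDiff_tensor_le h₁ h₂ hρ).trans (add_le_add ?_ ?_)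
  · exact N.informationDifference_le (QuantumChannel.applySnd_isDensity _ hρ)
  · exact M.informationDifference_le (QuantumChannel.applyFst_isDensity _ hρ)

open Pointwise in
theorem le_privateInformationEA_tensor [Nonempty a₁] [Nonempty a₂] :
    N.privateInformationEA + M.privateInformationEA ≤ (N.tensor M).privateInformationEA := by
  rw [privateInformationEA, privateInformationEA,
    ← csSup_add N.privateInformationValues_nonempty N.bddAbove_privateInformationValues
      M.privateInformationValues_nonempty M.bddAbove_privateInformationValues]
  refine csSup_le (N.privateInformationValues_nonempty.add M.privateInformationValues_nonempty) ?_
  rintro _ ⟨_, ⟨k, ρ, hρ, rfl⟩, _, ⟨l, σ, hσ, rfl⟩, rfl⟩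
  have hd := (hρ.kronecker hσ).submatrix (Equiv.prodProdProdComm (Fin k) (Fin l) a₁ a₂)
  have h := (N.tensor M).informationDifference_le hd
  rwa [informationDifference_tensor N M hd, QuantumChannel.infoDiff_tensor_kronecker _ _ _ _ hρ hσ]
    at h

end BroadcastChannel

theorem mainTheorem6 {a₁ a₂ ι₁ ι₂ : Type*} [Fintype a₁] [Nonempty a₁] [Fintype a₂] [Nonempty a₂]
    [Fintype ι₁] [DecidableEq ι₁] [Fintype ι₂] [DecidableEq ι₂]
    (N : BroadcastChannel a₁ ι₁) (M : BroadcastChannel a₂ ι₂)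
    (hN : N.IsDegraded) (hM : M.IsDegraded) :
    BddAbove N.privateInformationValues ∧ BddAbove M.privateInformationValues ∧
      BddAbove (N.tensor M).privateInformationValues ∧
      (N.tensor M).privateInformationEA = N.privateInformationEA + M.privateInformationEA :=
  ⟨N.bddAbove_privateInformationValues, M.bddAbove_privateInformationValues,
    (N.tensor M).bddAbove_privateInformationValues,
    le_antisymm (BroadcastChannel.privateInformationEA_tensor_le N M hN hM)
      (BroadcastChannel.le_privateInformationEA_tensor N M)⟩
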